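/- **Setting.** A positive sequence $M=(M_k)_{k\ge 0}$ is called a *weight sequence* if there is a constant $a>0$ with (1) $M_0=1$; (2) $M_k^2\le M_{k-1}M_{k+1}$ for $k\ge 1$; (3) $M_k\le a^kM_jM_{k-j}$ for $0\le j\le k$; (4) $M_{k+1}^k\le a^kM_k^{k+1}$ for $k\ge 0$; (5) $M_{k+1}/((k+1)M_k)$ is non-decreasing in $k\ge 1$; (6) $\sum_{k\ge p}M_k/M_{k+1}\le a\,p\,M_p/M_{p+1}$ for all $p\ge 1$ (in particular the series converges). Let $X=\mathbb{R}^d$, let $Y\subset\mathbb{R}^e$ be open, let $M,\tilde M$ be weight sequences, and write $z=(z_1,z_2)$ for points of $X\times Y$. For $f\in C^\infty(X\times Y,\mathbb{R})$ and $L_1,L_2>0$ put $$\|f\|_{L_1,L_2}=\sup_{(x,y)\in X\times Y}\ \sup_{\alpha,\beta}\frac{|\partial_x^\alpha\partial_y^\beta f(x,y)|}{L_1^{|\alpha|}L_2^{|\beta|}M_{|\alpha|}\tilde M_{|\beta|}}\in[0,\infty],$$ and let $\mathcal{C}^\infty_{M,\tilde M}(X\times Y)$ be the set of all $f\in C^\infty(X\times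 Y,\mathbb{R})$ with $\|f\|_{L_1,L_2}<\infty$ for some $L_1,L_2>0$. For a family $(f^{\alpha,\beta})$ of functions on $K\times Y$, $K\subset X$, indexed by multi-indices $\alpha\in\mathbb{N}^d$, $\beta\in\mathbb{N}^e$, and for $x\in K$, $z\in K\times Y$, $|\alpha|\le n$, put $$(R^n_xf)_{\alpha,\beta}(z)=f^{\alpha,\beta}(z)-\sum_{|\delta|\le n-|\alpha|}\frac{f^{\alpha+\delta,\beta}(x,z_2)}{\delta!}(z_1-x)^\delta .$$ **Theorem.** Let $M,\tilde M$ be weight sequences. There are constants $C_0,C_1>0$, depending only on $d$, $e$, $M$ and $\tilde M$, such that the following holds for every open $Y\subset\mathbb{R}^e$, every compact $K\subset\mathbb{R}^d$, all $A\ge 0$ and all $L_1,L_2>0$. Let $(f^{\alpha,\beta})$ be a family of continuous functions $f^{\alpha,\beta}:K\times Y\to\mathbb{R}$, $\alpha\in\mathbb{N}^d$, $\beta\in\mathbb{N}^e$, each smooth in $y\in Y$ for every fixed $x\in K$, such that $\partial_y^\gamma f^{\alpha,\beta}=f^{\alpha,\beta+\gamma}$ on $K\times Y$ for all $\alpha,\beta,\gamma$,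 and such that $$|f^{\alpha,\beta}(z)|\le A\,L_1^{|\alpha|}L_2^{|\beta|}M_{|\alpha|}\tilde M_{|\beta|}$$ for all $\alpha,\beta$ and all $z\in K\times Y$, and $$|(R^n_xf)_{k,l}(z)|\le A\,L_1^{n+1}M_{n+1}L_2^{|l|}\tilde M_{|l|}\,\frac{|z_1-x|^{n-|k|+1}}{(n-|k|+1)!}$$ for all $n\ge 0$, all $k\in\mathbb{N}^d$ with $|k|\le n$, all $l\in\mathbb{N}^e$, all $x\in K$ and all $z\in K\times Y$. Then there is a function $f\in\mathcal{C}^\infty_{M,\tilde M}(X\times Y)$ with $\partial_x^\alpha\partial_y^\beta f=f^{\alpha,\beta}$ on $K\times Y$ for all $\alpha,\beta$, and $$\|f\|_{C_1L_1,L_2}\le C_0A .$$ -/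

import Mathlib

open scoped ContDiff Nat

/-- The order `|α|` of a multi-index. -/
def miOrder {n : ℕ} (α : Fin n → ℕ) : ℕ := ∑ i, α i

/-- The factorial `α!` of a multi-index. -/
def miFactorial {n : ℕ} (α : Fin n → ℕ) : ℕ := ∏ i, (α i)!

/-- The monomial `v ^ α`. -/
def miPow {n : ℕ} (v : EuclideanSpace ℝ (Fin n)) (α : Fin n → ℕ) : ℝ := ∏ i, v i ^ α i

/-- The partial derivative of order `α` along the directions `e 0, …, e (n - 1)`:
`∂_{e 0} ^ (α 0) ⋯ ∂_{e (n - 1)} ^ (α (n - 1)) f`. It is only applied at interior points of sets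
on which `f` is smooth. -/
noncomputable def multiDeriv {E : Type*} [NormedAddCommGroup E] [NormedSpace ℝ E] {n : ℕ}
    (e : Fin n → E) (α : Fin n → ℕ) (f : E → ℝ) : E → ℝ :=
  (List.finRange n).foldr (fun i g => (fun (h : E → ℝ) (z : E) => fderiv ℝ h z (e i))^[α i] g) f

/-- The partial derivative `∂_y^γ g` of a function `g` of `y ∈ ℝ^n`. -/
noncomputable def partialDeriv {n : ℕ} (γ : Fin n → ℕ) (g : EuclideanSpace ℝ (Fin n) → ℝ) :
    EuclideanSpace ℝ (Fin n) → ℝ :=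
  multiDeriv (fun j => EuclideanSpace.single j (1 : ℝ)) γ g

/-- The mixed partial derivative `∂_x^α ∂_y^β f` of a function `f` of `(x, y) ∈ ℝ^d × ℝ^e`. -/
noncomputable def mixedDeriv {d e : ℕ} (α : Fin d → ℕ) (β : Fin e → ℕ)
    (f : EuclideanSpace ℝ (Fin d) × EuclideanSpace ℝ (Fin e) → ℝ) :
    EuclideanSpace ℝ (Fin d) × EuclideanSpace ℝ (Fin e) → ℝ :=
  multiDeriv (fun i => (EuclideanSpace.single i (1 : ℝ), 0)) α
    (multiDeriv (fun j => (0, EuclideanSpace.single j (1 : ℝ))) β f)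

/-- The conditions on a weight sequence. -/
def IsWeightSequence (M : ℕ → ℝ) : Prop :=
  (∀ k, 0 < M k) ∧ M 0 = 1 ∧
  (∀ k, 1 ≤ k → M k ^ 2 ≤ M (k - 1) * M (k + 1)) ∧
  (∀ k, 1 ≤ k → M (k + 1) / ((k + 1) * M k) ≤ M (k + 2) / ((k + 2) * M (k + 1))) ∧
  Summable (fun k => M k / M (k + 1)) ∧
  ∃ A : ℝ, 0 < A ∧
    (∀ j k, j ≤ k → M k ≤ A ^ k * (M j * M (k - j))) ∧
    (∀ k, M (k + 1) ^ k ≤ A ^ k * M k ^ (k + 1)) ∧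
    (∀ p : ℕ, 1 ≤ p → ∑' k, M (p + k) / M (p + k + 1) ≤ A * p * M p / M (p + 1))

/-- The norm `‖f‖_{L₁,L₂}` on `X × Y`, with values in `[0, ∞]`. -/
noncomputable def anisoNorm {d e : ℕ} (M N : ℕ → ℝ) (L₁ L₂ : ℝ)
    (X : Set (EuclideanSpace ℝ (Fin d))) (Y : Set (EuclideanSpace ℝ (Fin e)))
    (f : EuclideanSpace ℝ (Fin d) × EuclideanSpace ℝ (Fin e) → ℝ) : ENNReal :=
  ⨆ (z ∈ X ×ˢ Y) (α : Fin d → ℕ) (β : Fin e → ℕ),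
    ENNReal.ofReal (|mixedDeriv α β f z| /
      (L₁ ^ miOrder α * L₂ ^ miOrder β * M (miOrder α) * N (miOrder β)))

/-- The class `C^∞_{M,N}(X × Y)`, for open sets `X` and `Y`. -/
def MemAniso {d e : ℕ} (M N : ℕ → ℝ)
    (X : Set (EuclideanSpace ℝ (Fin d))) (Y : Set (EuclideanSpace ℝ (Fin e)))
    (f : EuclideanSpace ℝ (Fin d) × EuclideanSpace ℝ (Fin e) → ℝ) : Prop :=
  ContDiffOn ℝ ∞ f (X ×ˢ Y) ∧ ∃ L₁ L₂ : ℝ, 0 < L₁ ∧ 0 < L₂ ∧ anisoNorm M N L₁ L₂ X Y f < ⊤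

/-- The Taylor polynomial in the first variable of a jet `F`, at the base point `x`:
`(T^m_x F^{α,β})(z) = ∑_{|δ| ≤ m} F^{α+δ,β}(x, z₂) (z₁ - x)^δ / δ!`. -/
noncomputable def jetTaylor {d e : ℕ}
    (F : (Fin d → ℕ) → (Fin e → ℕ) → EuclideanSpace ℝ (Fin d) × EuclideanSpace ℝ (Fin e) → ℝ)
    (m : ℕ) (α : Fin d → ℕ) (β : Fin e → ℕ) (x : EuclideanSpace ℝ (Fin d))
    (z : EuclideanSpace ℝ (Fin d) × EuclideanSpace ℝ (Fin e)) : ℝ :=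
  ∑ j ∈ Finset.range (m + 1), ∑ δ ∈ Finset.piAntidiag (Finset.univ : Finset (Fin d)) j,
    F (α + δ) β (x, z.2) / (miFactorial δ : ℝ) * miPow (z.1 - x) δ

/-- The Taylor remainder `(R^n_x F)_{α,β}(z) = F^{α,β}(z) - (T^{n-|α|}_x F^{α,β})(z)` of a jet;
it is only used for `|α| ≤ n`. -/
noncomputable def jetRemainder {d e : ℕ}
    (F : (Fin d → ℕ) → (Fin e → ℕ) → EuclideanSpace ℝ (Fin d) × EuclideanSpace ℝ (Fin e) → ℝ)
    (n : ℕ) (α : Fin d → ℕ) (β : Fin e → ℕ) (x : EuclideanSpace ℝ (Fin d))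
    (z : EuclideanSpace ℝ (Fin d) × EuclideanSpace ℝ (Fin e)) : ℝ :=
  F α β z - jetTaylor F (n - miOrder α) α β x z

/-- `F` is a jet of continuous functions on `K × Y`, smooth in `y`, whose derivatives in `y` are
given by the jet itself. -/
def IsPartialJet {d e : ℕ}
    (K : Set (EuclideanSpace ℝ (Fin d))) (Y : Set (EuclideanSpace ℝ (Fin e)))
    (F : (Fin d → ℕ) → (Fin e → ℕ) → EuclideanSpace ℝ (Fin d) × EuclideanSpace ℝ (Fin e) → ℝ) :
    Prop :=
  ∀ α β, ContinuousOn (F α β) (K ×ˢ Y) ∧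
    ∀ x ∈ K, ContDiffOn ℝ ∞ (fun y => F α β (x, y)) Y ∧
      ∀ γ, ∀ y ∈ Y, partialDeriv γ (fun y' => F α β (x, y')) y = F α (β + γ) (x, y)

/-!
# Extension of anisotropic ultradifferentiable Whitney jets

The variable `y` is only a parameter: for fixed `y` and `β`, the functions `F · β (·, y)` form an
ordinary Whitney jet on `K` in the class of `M`, with bound `A * L₂ ^ |β| * N |β|`. It suffices to
extend such jets by operators that are series of finite sums of terms `c ↦ c δ x • u`, with `x ∈ K`
and `u` smooth (`JetOp`): these commute with derivatives in `y`, and so turn the partial jet `F` into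
a function on `ℝ^d × Y` whose derivatives in `y` have the constants of `F`
(`JetOp.isMixedJet`, `IsMixedJet.isMixedJet_tsum`). Moreover `M k` may be replaced by `L₁ ^ k * M k`,
since all the properties of `M` that are used are invariant under this change (`ScaleRegular`).

The operators in `x` (`exists_extension_operators`) use no decomposition of the complement of `K`.
Let `m p = M (p + 1) / M p`, and attach to the Taylor order `p` the scale `r p = κ (p + 1) / m p`.
At this scale there is a partition of unity of a neighbourhood of `K`, made of translates of one bump
along a grid of width `r p`; let `S p` be the sum of its members, each multiplied by the Taylor
polynomial of order `p` at a point of `K` near its cell. Two facts meet.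

* The strong non-quasianalyticity `∑ k ≥ p, 1 / m k ≤ a (p + 1) / m p` leaves room for steps of width
  `r p` obtained by averaging over intervals of radii proportional to `1 / m (max j p)`, for
  `j = 0, 1, …`. Their derivatives of order `q` are at most `C ^ q * ∏ j < q, m (max j p)`, hence at
  most `C ^ q * (m p ^ p / M p) * M q`, and the moderate growth of `M` bounds the middle factor by
  `a ^ p` (`ScaleRegular.exists_step`). So the partitions of unity cost a factor that is geometric
  in `p`, with a ratio that does not depend on `κ`.
* Taylor polynomials of order `p` at points of `K` whose distance is comparable to `r p` differ, in
  their derivatives of order `q`, by at most `(C * κ) ^ p * C' ^ q * M q`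
  (`WhitneyJet.abs_dirWord_jetPoly_sub_le'`). For small `κ` this beats the cost above.

Hence the series of the differences `S (p + 1) - S p`, localized near `K` by the partitions of unity
themselves, converges geometrically together with all its derivatives and with the bounds of the
class of `M`. Its sum is therefore smooth everywhere, including at the points of `K`; there the
series telescopes, and its derivatives are the limits of those of `S p`, which are the entries of
the jet.
-/


/-! ### Iterated directional derivatives along words -/

section Words

variable {E : Type*} [NormedAddCommGroup E] [NormedSpace ℝ E] {n : ℕ}

/-- The iterated directional derivative `∂_{e i₁} ⋯ ∂_{e iₖ} f` along the word `i₁ ⋯ iₖ`. -/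
noncomputable def dirWord (e : Fin n → E) (w : List (Fin n)) (f : E → ℝ) : E → ℝ :=
  w.foldr (fun i (g : E → ℝ) (z : E) => fderiv ℝ g z (e i)) f

/-- The word `0 ⋯ 0 1 ⋯ 1 ⋯` in which the letter `i` occurs `α i` times. -/
def miWord (α : Fin n → ℕ) : List (Fin n) :=
  (List.finRange n).flatMap fun i => List.replicate (α i) i

theorem count_miWord (α : Fin n → ℕ) (i : Fin n) : (miWord α).count i = α i := by
  have h : ∀ l : List (Fin n), l.Nodup →
      (l.flatMap fun i => List.replicate (α i) i).count i = if i ∈ l then α i else 0 := by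
    intro l
    induction l with
    | nil => simp
    | cons j l ih =>
      intro hl
      rw [List.nodup_cons] at hl
      rw [List.flatMap_cons, List.count_append, ih hl.2, List.count_replicate]
      by_cases hij : i = j
      · subst hij
        simp [hl.1]
      · have hji : ¬ j = i := fun h => hij h.symm
        simp [hij, hji]
  rw [miWord, h _ (List.nodup_finRange n)]
  simp

theorem length_eq_sum_count (w : List (Fin n)) : w.length = ∑ i, w.count i := by
  induction w with
  | nil => simp
  | cons j w ih =>
    simp only [List.length_cons, List.count_cons, Finset.sum_add_distrib, ← ih]
    simp

theorem length_miWord (α : Fin n → ℕ) : (miWord α).length = miOrder α := by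
  rw [length_eq_sum_count]
  simp [count_miWord, miOrder]

theorem multiDeriv_eq_dirWord (e : Fin n → E) (α : Fin n → ℕ) (f : E → ℝ) :
    multiDeriv e α f = dirWord e (miWord α) f := by
  have hrep : ∀ (k : ℕ) (i : Fin n) (g : E → ℝ),
      (fun (h : E → ℝ) (z : E) => fderiv ℝ h z (e i))^[k] g =
        (List.replicate k i).foldr (fun i (g : E → ℝ) (z : E) => fderiv ℝ g z (e i)) g := by
    intro k i g
    induction k with
    | zero => simp
    | succ k ih => rw [Function.iterate_succ_apply', ih, List.replicate_succ, List.foldr_cons]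
  unfold multiDeriv dirWord miWord
  induction List.finRange n with
  | nil => simp
  | cons j l ih => rw [List.foldr_cons, List.flatMap_cons, List.foldr_append, ih, hrep]

variable (e : Fin n → E)

@[simp] theorem dirWord_nil (f : E → ℝ) : dirWord e [] f = f := rfl

theorem dirWord_cons (i : Fin n) (w : List (Fin n)) (f : E → ℝ) :
    dirWord e (i :: w) f = fun z => fderiv ℝ (dirWord e w f) z (e i) := rfl

theorem dirWord_concat (w : List (Fin n)) (i : Fin n) (f : E → ℝ) :
    dirWord e (w ++ [i]) f = dirWord e w (fun z => fderiv ℝ f z (e i)) := by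
  simp [dirWord, List.foldr_append]

theorem ContDiff.fderiv_dir {f : E → ℝ} (hf : ContDiff ℝ ∞ f) (v : E) :
    ContDiff ℝ ∞ fun z => fderiv ℝ f z v :=
  (hf.fderiv_right (m := ∞) (by simp)).clm_apply contDiff_const

theorem ContDiff.dirWord {f : E → ℝ} (hf : ContDiff ℝ ∞ f) (w : List (Fin n)) :
    ContDiff ℝ ∞ (dirWord e w f) := by
  induction w with
  | nil => exact hf
  | cons i w ih => exact ih.fderiv_dir _

theorem ContDiff.differentiable_infty {f : E → ℝ} (hf : ContDiff ℝ ∞ f) : Differentiable ℝ f :=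
  hf.differentiable (by simp)

theorem dirWord_add {f g : E → ℝ} (hf : ContDiff ℝ ∞ f) (hg : ContDiff ℝ ∞ g)
    (w : List (Fin n)) (z : E) :
    dirWord e w (fun z => f z + g z) z = dirWord e w f z + dirWord e w g z := by
  induction w generalizing z with
  | nil => rfl
  | cons i w ih =>
    simp only [dirWord_cons]
    rw [funext ih, fderiv_fun_add (hf.dirWord e w).differentiable_infty.differentiableAt
      (hg.dirWord e w).differentiable_infty.differentiableAt]
    rfl

theorem dirWord_const_mul {f : E → ℝ} (hf : ContDiff ℝ ∞ f) (c : ℝ)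
    (w : List (Fin n)) (z : E) :
    dirWord e w (fun z => c * f z) z = c * dirWord e w f z := by
  induction w generalizing z with
  | nil => rfl
  | cons i w ih =>
    simp only [dirWord_cons]
    rw [funext ih, fderiv_const_mul (hf.dirWord e w).differentiable_infty.differentiableAt]
    rfl

theorem dirWord_zero (w : List (Fin n)) (z : E) : dirWord e w (fun _ => (0 : ℝ)) z = 0 := by
  have := dirWord_const_mul e (contDiff_const (c := (0 : ℝ))) 0 w z
  simpa using this

theorem dirWord_sub {f g : E → ℝ} (hf : ContDiff ℝ ∞ f) (hg : ContDiff ℝ ∞ g)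
    (w : List (Fin n)) (z : E) :
    dirWord e w (fun z => f z - g z) z = dirWord e w f z - dirWord e w g z := by
  have h := dirWord_add e hf (contDiff_const.mul hg : ContDiff ℝ ∞ fun z => (-1) * g z) w z
  rw [dirWord_const_mul e hg] at h
  simpa [sub_eq_add_neg] using h

theorem dirWord_sum {ι : Type*} (s : Finset ι) {f : ι → E → ℝ}
    (hf : ∀ i ∈ s, ContDiff ℝ ∞ (f i)) (w : List (Fin n)) (z : E) :
    dirWord e w (fun z => ∑ i ∈ s, f i z) z = ∑ i ∈ s, dirWord e w (f i) z := by
  classical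
  induction s using Finset.induction_on with
  | empty => simpa using dirWord_zero e w z
  | insert i s hi ih =>
    simp only [Finset.sum_insert hi]
    rw [dirWord_add e (hf i (Finset.mem_insert_self i s))
      (ContDiff.sum fun j hj => hf j (Finset.mem_insert_of_mem hj)),
      ih fun j hj => hf j (Finset.mem_insert_of_mem hj)]

theorem dirWord_congr {f g : E → ℝ} {z : E} (h : f =ᶠ[nhds z] g) (w : List (Fin n)) :
    dirWord e w f =ᶠ[nhds z] dirWord e w g := by
  induction w with
  | nil => exact h
  | cons i w ih =>
    filter_upwards [ih.fderiv (𝕜 := ℝ)] with y hy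
    simp only [dirWord_cons]
    rw [hy]

/-- Directional derivatives of a smooth function commute. -/
theorem dirWord_perm {f : E → ℝ} (hf : ContDiff ℝ ∞ f) {w w' : List (Fin n)} (h : w.Perm w') :
    dirWord e w f = dirWord e w' f := by
  induction h with
  | nil => rfl
  | cons i _ ih => simp only [dirWord_cons, ih]
  | trans _ _ ih₁ ih₂ => exact ih₁.trans ih₂
  | swap i j w =>
    have hg := hf.dirWord e w
    have key : ∀ (u v z : E), fderiv ℝ (fun z => fderiv ℝ (dirWord e w f) z u) z v =
        fderiv ℝ (fderiv ℝ (dirWord e w f)) z v u := by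
      intro u v z
      have hd : DifferentiableAt ℝ (fderiv ℝ (dirWord e w f)) z :=
        ((hg.fderiv_right (m := ∞) (by simp)).differentiable (by simp)).differentiableAt
      rw [fderiv_clm_apply hd (differentiableAt_const u)]
      simp
    funext z
    simp only [dirWord_cons]
    rw [key, key]
    refine (hg.contDiffAt.isSymmSndFDerivAt ?_).eq _ _
    rw [minSmoothness_of_isRCLikeNormedField]
    exact WithTop.coe_le_coe.2 (le_top : (2 : ℕ∞) ≤ ⊤)

theorem dirWord_cons_miWord {f : E → ℝ} (hf : ContDiff ℝ ∞ f) (i : Fin n) (α : Fin n → ℕ) :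
    dirWord e (i :: miWord α) f = dirWord e (miWord (α + Pi.single i 1)) f := by
  refine dirWord_perm e hf (List.perm_iff_count.2 fun j => ?_)
  rw [count_miWord, List.count_cons, count_miWord]
  by_cases h : i = j
  · subst h; simp
  · have : ¬ j = i := fun h' => h h'.symm
    simp [h, this]

/-- If the family `H` is stable under the directional derivatives on the open set `U`, so that
`∂_{e i} (H a) = H (s i a)`, then the words act on `H` through the maps `s i`. -/
theorem dirWord_eqOn {ι : Type*} {U : Set E} (hU : IsOpen U) (H : ι → E → ℝ) (s : Fin n → ι → ι)
    (hH : ∀ i a, ∀ z ∈ U, fderiv ℝ (H a) z (e i) = H (s i a) z) {f : E → ℝ} {a : ι}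
    (hf : Set.EqOn f (H a) U) (w : List (Fin n)) :
    Set.EqOn (dirWord e w f) (H (w.foldr s a)) U := by
  induction w with
  | nil => exact hf
  | cons i w ih =>
    intro z hz
    have : dirWord e w f =ᶠ[nhds z] H (w.foldr s a) := by
      filter_upwards [hU.mem_nhds hz] with y hy using ih hy
    simp only [dirWord_cons, List.foldr_cons]
    rw [this.fderiv_eq, hH i _ z hz]

theorem foldr_add_single (w : List (Fin n)) (α : Fin n → ℕ) :
    w.foldr (fun i β => β + Pi.single i 1) α = α + fun i => w.count i := by
  induction w with
  | nil => funext i; simp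
  | cons j w ih =>
    rw [List.foldr_cons, ih]
    funext i
    by_cases h : i = j
    · subst h; simp [List.count_cons, add_assoc]
    · have : ¬ j = i := fun h' => h h'.symm
      simp [List.count_cons, h, this]

/-- The product rule as a bound: the powers of two count the terms. -/
theorem abs_dirWord_mul_le (w : List (Fin n)) {z : E} {u v : E → ℝ} (hu : ContDiff ℝ ∞ u)
    (hv : ContDiff ℝ ∞ v) {a b c : ℕ → ℝ} (ha : ∀ w, |dirWord e w u z| ≤ a w.length)
    (hb : ∀ w, |dirWord e w v z| ≤ b w.length) (hc : ∀ i j, a i * b j ≤ c (i + j)) :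
    |dirWord e w (fun z => u z * v z) z| ≤ 2 ^ w.length * c w.length := by
  induction w using List.reverseRecOn generalizing u v a b c with
  | nil =>
    simp only [dirWord_nil, List.length_nil, pow_zero, one_mul, abs_mul]
    exact (mul_le_mul (ha []) (hb []) (abs_nonneg _) ((abs_nonneg _).trans (ha []))).trans (hc 0 0)
  | append_singleton w i ih =>
    have hprod : (fun z => fderiv ℝ (fun z => u z * v z) z (e i)) =
        fun z => u z * fderiv ℝ v z (e i) + fderiv ℝ u z (e i) * v z := by
      funext y
      rw [fderiv_fun_mul hu.differentiable_infty.differentiableAt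
        hv.differentiable_infty.differentiableAt]
      simp [mul_comm]
    rw [dirWord_concat, hprod, dirWord_add e (hu.mul (hv.fderiv_dir _))
      ((hu.fderiv_dir _).mul hv)]
    have h₁ := ih hu (hv.fderiv_dir (e i)) (a := a) (b := fun j => b (j + 1))
      (c := fun j => c (j + 1)) ha
      (fun w => by simpa [dirWord_concat] using hb (w ++ [i])) (fun i j => hc i (j + 1))
    have h₂ := ih (hu.fderiv_dir (e i)) hv (a := fun j => a (j + 1)) (b := b)
      (c := fun j => c (j + 1))
      (fun w => by simpa [dirWord_concat] using ha (w ++ [i])) hb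
      (fun i j => by simpa [add_right_comm] using hc (i + 1) j)
    refine (abs_add_le _ _).trans ((add_le_add h₁ h₂).trans (le_of_eq ?_))
    simp only [List.length_append, List.length_singleton]
    ring

theorem dirWord_mul_eq_zero (w : List (Fin n)) {z : E} {u v : E → ℝ} (hu : ContDiff ℝ ∞ u)
    (hv : ContDiff ℝ ∞ v) (hz : ∀ w, dirWord e w u z = 0) :
    dirWord e w (fun z => u z * v z) z = 0 := by
  induction w using List.reverseRecOn generalizing u v with
  | nil => simpa using Or.inl (hz [])
  | append_singleton w i ih =>
    have hprod : (fun z => fderiv ℝ (fun z => u z * v z) z (e i)) =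
        fun z => u z * fderiv ℝ v z (e i) + fderiv ℝ u z (e i) * v z := by
      funext y
      rw [fderiv_fun_mul hu.differentiable_infty.differentiableAt
        hv.differentiable_infty.differentiableAt]
      simp [mul_comm]
    rw [dirWord_concat, hprod, dirWord_add e (hu.mul (hv.fderiv_dir _))
      ((hu.fderiv_dir _).mul hv), ih hu (hv.fderiv_dir _) hz, ih (hu.fderiv_dir _) hv
      fun w => by simpa [dirWord_concat] using hz (w ++ [i]), add_zero]

end Words

/-! ### Tensor products of functions of one variable -/

section Tensor

variable {d : ℕ}

/-- The standard basis vectors of `ℝ^d`. -/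
noncomputable def stdDir (d : ℕ) (i : Fin d) : EuclideanSpace ℝ (Fin d) :=
  EuclideanSpace.single i (1 : ℝ)

theorem stdDir_apply (i j : Fin d) : stdDir d i j = if j = i then 1 else 0 := by
  simp [stdDir]

/-- The function `z ↦ ∏ j, u j (z j)`. -/
def tensorFun (u : Fin d → ℝ → ℝ) (z : EuclideanSpace ℝ (Fin d)) : ℝ := ∏ j, u j (z j)

theorem contDiff_tensorFun {u : Fin d → ℝ → ℝ} (hu : ∀ j, ContDiff ℝ ∞ (u j)) :
    ContDiff ℝ ∞ (tensorFun u) := by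
  unfold tensorFun
  refine contDiff_prod fun j _ => (hu j).comp ?_
  fun_prop

theorem fderiv_tensorFun {u : Fin d → ℝ → ℝ} (hu : ∀ j, ContDiff ℝ ∞ (u j)) (i : Fin d)
    (z : EuclideanSpace ℝ (Fin d)) :
    fderiv ℝ (tensorFun u) z (stdDir d i) =
      tensorFun (Function.update u i (deriv (u i))) z := by
  have h : ∀ j, HasFDerivAt (fun z : EuclideanSpace ℝ (Fin d) => u j (z j))
      (deriv (u j) (z j) • (EuclideanSpace.proj j : EuclideanSpace ℝ (Fin d) →L[ℝ] ℝ)) z := by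
    intro j
    have h₁ := (hu j).differentiable_infty.differentiableAt (x := z j) |>.hasDerivAt
    exact h₁.comp_hasFDerivAt z
      (EuclideanSpace.proj j : EuclideanSpace ℝ (Fin d) →L[ℝ] ℝ).hasFDerivAt
  have h' := HasFDerivAt.finsetProd (u := Finset.univ) fun j _ => h j
  have h2 : fderiv ℝ (tensorFun u) z = _ := h'.fderiv
  rw [h2]
  have hp : ∀ j, (EuclideanSpace.proj j : EuclideanSpace ℝ (Fin d) →L[ℝ] ℝ) (stdDir d i) =
      if j = i then 1 else 0 := fun j => stdDir_apply i j
  simp only [sum_apply, smul_apply, smul_eq_mul, hp]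
  rw [Finset.sum_eq_single i (fun j _ hj => by simp [hj]) (by simp)]
  unfold tensorFun
  rw [← Finset.prod_erase_mul _ _ (Finset.mem_univ i)]
  simp only [if_true, mul_one, Function.update_self]
  congr 1
  exact Finset.prod_congr rfl fun j hj => by rw [Function.update_of_ne (Finset.ne_of_mem_erase hj)]

theorem ContDiff.iteratedDeriv_infty {g : ℝ → ℝ} (hg : ContDiff ℝ ∞ g) (q : ℕ) :
    ContDiff ℝ ∞ (iteratedDeriv q g) := by
  induction q with
  | zero => simpa using hg
  | succ q ih =>
    rw [iteratedDeriv_succ]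
    exact ((contDiff_infty_iff_deriv (𝕜 := ℝ)).1 ih).2

/-- The words act on a tensor product through the derivatives of the factors. -/
theorem dirWord_tensorFun {u : Fin d → ℝ → ℝ} (hu : ∀ j, ContDiff ℝ ∞ (u j)) (w : List (Fin d)) :
    dirWord (stdDir d) w (tensorFun u) = tensorFun fun j => iteratedDeriv (w.count j) (u j) := by
  have := dirWord_eqOn (stdDir d) isOpen_univ
    (fun (α : Fin d → ℕ) => tensorFun fun j => iteratedDeriv (α j) (u j))
    (fun i α => α + Pi.single i 1) (fun i α z _ => by
      rw [fderiv_tensorFun fun j => (hu j).iteratedDeriv_infty _]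
      congr 1
      funext j
      by_cases h : j = i
      · subst h; simp [iteratedDeriv_succ]
      · simp [h]) (f := tensorFun u) (a := 0) (fun z _ => by simp) w
  rw [foldr_add_single] at this
  funext z
  rw [this (Set.mem_univ z)]
  simp

end Tensor

/-! ### Smooth steps with controlled derivatives -/

section Cutoff

/-- The average of `g` over the interval of radius `b` around `x`. -/
noncomputable def boxAverage (b : ℝ) (g : ℝ → ℝ) (x : ℝ) : ℝ :=
  (2 * b)⁻¹ * ∫ t in (x - b)..(x + b), g t

theorem hasDerivAt_boxAverage (b : ℝ) {g : ℝ → ℝ} (hg : Continuous g) (x : ℝ) :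
    HasDerivAt (boxAverage b g) ((2 * b)⁻¹ * (g (x + b) - g (x - b))) x := by
  have hG : ∀ u, HasDerivAt (fun u => ∫ t in (0 : ℝ)..u, g t) (g u) u := fun u =>
    intervalIntegral.integral_hasDerivAt_right (hg.intervalIntegrable _ _)
      hg.stronglyMeasurable.stronglyMeasurableAtFilter hg.continuousAt
  have hsplit : boxAverage b g =
      fun x => (2 * b)⁻¹ * ((∫ t in (0 : ℝ)..(x + b), g t) - ∫ t in (0 : ℝ)..(x - b), g t) := by
    funext y
    rw [boxAverage, intervalIntegral.integral_interval_sub_left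
      (hg.intervalIntegrable _ _) (hg.intervalIntegrable _ _)]
  rw [hsplit]
  refine HasDerivAt.const_mul _ (HasDerivAt.sub ?_ ?_)
  · simpa using (hG (x + b)).comp_add_const x b
  · simpa using (hG (x - b)).comp_sub_const x b

theorem deriv_boxAverage (b : ℝ) {g : ℝ → ℝ} (hg : Continuous g) :
    deriv (boxAverage b g) = fun x => (2 * b)⁻¹ * (g (x + b) - g (x - b)) :=
  funext fun x => (hasDerivAt_boxAverage b hg x).deriv

theorem contDiff_boxAverage (b : ℝ) {g : ℝ → ℝ} (hg : ContDiff ℝ ∞ g) :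
    ContDiff ℝ ∞ (boxAverage b g) := by
  refine (contDiff_infty_iff_deriv (𝕜 := ℝ)).2
    ⟨fun x => (hasDerivAt_boxAverage b hg.continuous x).differentiableAt, ?_⟩
  rw [deriv_boxAverage b hg.continuous]
  exact contDiff_const.mul ((hg.comp (contDiff_id.add contDiff_const)).sub
    (hg.comp (contDiff_id.sub contDiff_const)))

theorem deriv_boxAverage_eq (b : ℝ) {g : ℝ → ℝ} (hg : ContDiff ℝ ∞ g) :
    deriv (boxAverage b g) = boxAverage b (deriv g) := by
  rw [deriv_boxAverage b hg.continuous]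
  funext x
  rw [boxAverage, intervalIntegral.integral_deriv_eq_sub
    (fun y _ => hg.differentiable_infty.differentiableAt)
    (((contDiff_infty_iff_deriv (𝕜 := ℝ)).1 hg).2.continuous.intervalIntegrable _ _)]

theorem iteratedDeriv_boxAverage (b : ℝ) {g : ℝ → ℝ} (hg : ContDiff ℝ ∞ g) (q : ℕ) :
    iteratedDeriv q (boxAverage b g) = boxAverage b (iteratedDeriv q g) := by
  induction q with
  | zero => simp
  | succ q ih => rw [iteratedDeriv_succ, ih, deriv_boxAverage_eq b (hg.iteratedDeriv_infty q),
      iteratedDeriv_succ]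

theorem abs_boxAverage_le {b : ℝ} (hb : 0 < b) {g : ℝ → ℝ} {C : ℝ} (h : ∀ t, |g t| ≤ C) (x : ℝ) :
    |boxAverage b g x| ≤ C := by
  have := intervalIntegral.norm_integral_le_of_norm_le_const (a := x - b) (b := x + b) (f := g)
    (C := C) fun t _ => h t
  rw [boxAverage, abs_mul, abs_of_pos (by positivity), inv_mul_le_iff₀ (by positivity)]
  refine this.trans (le_of_eq ?_)
  rw [show x + b - (x - b) = 2 * b by ring, abs_of_pos (by positivity)]
  ring

theorem boxAverage_const {b : ℝ} (hb : 0 < b) {g : ℝ → ℝ} {c x : ℝ}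
    (h : ∀ t, x - b ≤ t → t ≤ x + b → g t = c) : boxAverage b g x = c := by
  have : ∫ t in (x - b)..(x + b), g t = ∫ _t in (x - b)..(x + b), c := by
    refine intervalIntegral.integral_congr fun t ht => ?_
    rw [Set.uIcc_of_le (by linarith)] at ht
    exact h t ht.1 ht.2
  rw [boxAverage, this, intervalIntegral.integral_const, smul_eq_mul]
  field_simp
  ring

theorem abs_boxAverage_sub_le {b : ℝ} (hb : 0 < b) {g : ℝ → ℝ} (hg : Differentiable ℝ g) {C : ℝ}
    (h : ∀ t, |deriv g t| ≤ C) (x : ℝ) : |boxAverage b g x - g x| ≤ b * C := by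
  have hC : 0 ≤ C := (abs_nonneg _).trans (h 0)
  have h₁ : boxAverage b g x - g x = (2 * b)⁻¹ * ∫ t in (x - b)..(x + b), (g t - g x) := by
    rw [intervalIntegral.integral_sub (hg.continuous.intervalIntegrable _ _)
      intervalIntegrable_const, boxAverage, intervalIntegral.integral_const, smul_eq_mul]
    field_simp
    ring
  have h₂ := intervalIntegral.norm_integral_le_of_norm_le_const (a := x - b) (b := x + b)
    (f := fun t => g t - g x) (C := C * b) fun t ht => by
      rw [Set.uIoc_of_le (by linarith)] at ht
      refine (Convex.norm_image_sub_le_of_norm_deriv_le (f := g) (fun y _ => hg y)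
        (fun y _ => h y) convex_univ (Set.mem_univ x) (Set.mem_univ t)).trans ?_
      refine mul_le_mul_of_nonneg_left ?_ hC
      rw [Real.norm_eq_abs, abs_le]
      constructor <;> linarith [ht.1, ht.2]
  rw [h₁, abs_mul, abs_of_pos (by positivity : 0 < (2 * b)⁻¹), inv_mul_le_iff₀ (by positivity)]
  refine h₂.trans (le_of_eq ?_)
  rw [show x + b - (x - b) = 2 * b by ring, abs_of_pos (by positivity)]
  ring

/-- The averages of `g` over intervals of radii `b 0, …, b (n - 1)`, in turn. -/
noncomputable def iterAverage (b : ℕ → ℝ) (g : ℝ → ℝ) : ℕ → ℝ → ℝ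
  | 0 => g
  | n + 1 => boxAverage (b n) (iterAverage b g n)

variable {b : ℕ → ℝ} {g : ℝ → ℝ}

theorem contDiff_iterAverage (hg : ContDiff ℝ ∞ g) (n : ℕ) :
    ContDiff ℝ ∞ (iterAverage b g n) := by
  induction n with
  | zero => exact hg
  | succ n ih => exact contDiff_boxAverage _ ih

theorem abs_iteratedDeriv_iterAverage_le (hb : ∀ j, 0 < b j) (hg : ContDiff ℝ ∞ g) {q : ℕ} {V : ℝ}
    (hV : ∀ x, |iteratedDeriv q g x| ≤ V) (n : ℕ) (x : ℝ) :
    |iteratedDeriv q (iterAverage b g n) x| ≤ V := by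
  induction n generalizing x with
  | zero => exact hV x
  | succ n ih =>
    rw [iterAverage, iteratedDeriv_boxAverage _ (contDiff_iterAverage hg n)]
    exact abs_boxAverage_le (hb n) ih x

/-- Every averaging pays for one derivative, at the price of the inverse of its radius. -/
theorem abs_iteratedDeriv_iterAverage_le_prod (hb : ∀ j, 0 < b j) (hg : ContDiff ℝ ∞ g)
    (h1 : ∀ x, |g x| ≤ 1) (n q : ℕ) (hq : q ≤ n) (x : ℝ) :
    |iteratedDeriv q (iterAverage b g n) x| ≤ ∏ j ∈ Finset.range q, (b j)⁻¹ := by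
  induction n generalizing q x with
  | zero =>
    obtain rfl : q = 0 := by omega
    simpa [iterAverage] using h1 x
  | succ n ih =>
    have hc := contDiff_iterAverage (b := b) hg n
    rcases hq.lt_or_eq with hq | rfl
    · rw [iterAverage, iteratedDeriv_boxAverage _ hc]
      exact abs_boxAverage_le (hb n) (ih q (by omega)) x
    · have hbn := hb n
      rw [iteratedDeriv_succ, iterAverage, iteratedDeriv_boxAverage _ hc,
        deriv_boxAverage _ (hc.iteratedDeriv_infty n).continuous, Finset.prod_range_succ]
      have h₁ := ih n le_rfl (x + b n)
      have h₂ := ih n le_rfl (x - b n)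
      set P := ∏ j ∈ Finset.range n, (b j)⁻¹
      rw [abs_mul, abs_of_pos (by positivity : 0 < (2 * b n)⁻¹), inv_mul_le_iff₀ (by positivity)]
      refine (abs_sub _ _).trans ((add_le_add h₁ h₂).trans (le_of_eq ?_))
      field_simp
      ring

theorem iterAverage_const_left (hb : ∀ j, 0 < b j) {s c : ℝ} (h : ∀ t ≤ s, g t = c) (n : ℕ) {x : ℝ}
    (hx : x ≤ s - ∑ j ∈ Finset.range n, b j) : iterAverage b g n x = c := by
  induction n generalizing x with
  | zero => exact h x (by simpa using hx)
  | succ n ih =>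
    rw [Finset.sum_range_succ] at hx
    exact boxAverage_const (hb n) fun t _ h₂ => ih (by linarith)

theorem iterAverage_const_right (hb : ∀ j, 0 < b j) {s c : ℝ} (h : ∀ t, s ≤ t → g t = c) (n : ℕ)
    {x : ℝ} (hx : s + ∑ j ∈ Finset.range n, b j ≤ x) : iterAverage b g n x = c := by
  induction n generalizing x with
  | zero => exact h x (by simpa using hx)
  | succ n ih =>
    rw [Finset.sum_range_succ] at hx
    exact boxAverage_const (hb n) fun t h₁ _ => ih (by linarith)

theorem exists_smooth_step_bounded {r : ℝ} (hr : 0 < r) :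
    ∃ g : ℝ → ℝ, ContDiff ℝ ∞ g ∧ (∀ x ≤ r / 4, g x = 0) ∧ (∀ x, 3 * r / 4 ≤ x → g x = 1) ∧
      (∀ x, |g x| ≤ 1) ∧ ∀ q, ∃ V, ∀ x, |iteratedDeriv q g x| ≤ V := by
  have hc : ContDiff ℝ ∞ fun x : ℝ => Real.smoothTransition ((x - r / 4) / (r / 2)) :=
    Real.smoothTransition.contDiff.comp ((contDiff_id.sub contDiff_const).div_const _)
  have h0 : ∀ x ≤ r / 4, Real.smoothTransition ((x - r / 4) / (r / 2)) = 0 := fun x hx =>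
    Real.smoothTransition.zero_of_nonpos (div_nonpos_of_nonpos_of_nonneg (by linarith) (by linarith))
  have h1 : ∀ x, 3 * r / 4 ≤ x → Real.smoothTransition ((x - r / 4) / (r / 2)) = 1 := fun x hx =>
    Real.smoothTransition.one_of_one_le (by rw [le_div_iff₀ (by linarith)]; linarith)
  have hb : ∀ x, |Real.smoothTransition ((x - r / 4) / (r / 2))| ≤ 1 := fun x => by
    rw [abs_of_nonneg (Real.smoothTransition.nonneg _)]
    exact Real.smoothTransition.le_one _
  refine ⟨_, hc, h0, h1, hb, fun q => ?_⟩
  rcases Nat.eq_zero_or_pos q with rfl | hq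
  · exact ⟨1, by simpa using hb⟩
  · obtain ⟨C, hC⟩ := (isCompact_Icc (a := r / 4) (b := 3 * r / 4)).exists_bound_of_continuousOn
      (hc.iteratedDeriv_infty q).continuous.continuousOn
    refine ⟨max C 0, fun x => ?_⟩
    have hconst : ∀ c : ℝ, (fun x : ℝ => Real.smoothTransition ((x - r / 4) / (r / 2))) =ᶠ[nhds x]
        (fun _ => c) →
        iteratedDeriv q (fun x : ℝ => Real.smoothTransition ((x - r / 4) / (r / 2))) x = 0 := by
      intro c h
      rw [h.iteratedDeriv_eq, iteratedDeriv_const]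
      simp [hq.ne']
    by_cases hx : x ∈ Set.Icc (r / 4) (3 * r / 4)
    · exact (hC x hx).trans (le_max_left _ _)
    · rw [Set.mem_Icc, not_and_or, not_le, not_le] at hx
      have : iteratedDeriv q (fun x : ℝ => Real.smoothTransition ((x - r / 4) / (r / 2))) x = 0 := by
        rcases hx with hx | hx
        · exact hconst 0 (by filter_upwards [Iio_mem_nhds hx] with y hy using h0 y (le_of_lt hy))
        · exact hconst 1 (by filter_upwards [Ioi_mem_nhds hx] with y hy using h1 y (le_of_lt hy))
      rw [this, abs_zero]
      exact le_max_right _ _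

/-- A smooth step from `0` to `1` on `[0, r]` whose derivative of order `q` is at most
`∏ j < q, 1 / b j`, for any radii `b j` of total length at most `r / 4`. It is the limit of the
averages of a fixed smooth step over intervals of radii `b 0`, `b 1`, …. -/
theorem exists_smooth_step {r : ℝ} (hr : 0 < r) (hb : ∀ j, 0 < b j) (hs : Summable b)
    (hsum : ∑' j, b j ≤ r / 4) :
    ∃ h : ℝ → ℝ, ContDiff ℝ ∞ h ∧ (∀ x ≤ 0, h x = 0) ∧ (∀ x, r ≤ x → h x = 1) ∧
      ∀ q x, |iteratedDeriv q h x| ≤ ∏ j ∈ Finset.range q, (b j)⁻¹ := by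
  obtain ⟨g, hg, h0, h1, hle, hV⟩ := exists_smooth_step_bounded hr
  choose V hV using hV
  set G := iterAverage b g with hG
  have hGc : ∀ n, ContDiff ℝ ∞ (G n) := contDiff_iterAverage hg
  have hd : ∀ n q x, iteratedDeriv q (fun x => G (n + 1) x - G n x) x =
      iteratedDeriv q (G (n + 1)) x - iteratedDeriv q (G n) x := fun n q x =>
    iteratedDeriv_sub ((hGc _).contDiffAt.of_le (mod_cast le_top))
      ((hGc _).contDiffAt.of_le (mod_cast le_top))
  have hbound : ∀ q n x, |iteratedDeriv q (fun x => G (n + 1) x - G n x) x| ≤ b n * V (q + 1) := by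
    intro q n x
    rw [hd, hG, iterAverage, iteratedDeriv_boxAverage _ (hGc n)]
    refine abs_boxAverage_sub_le (hb n) ((hGc n).iteratedDeriv_infty q).differentiable_infty
      (fun t => ?_) x
    rw [← iteratedDeriv_succ]
    exact abs_iteratedDeriv_iterAverage_le hb hg (hV (q + 1)) n t
  have hvs : ∀ q : ℕ, Summable fun n => b n * V (q + 1) := fun q => hs.mul_right _
  have hfb : ∀ (k : ℕ) (i : ℕ) (x : ℝ), (k : ℕ∞) ≤ ⊤ →
      ‖iteratedFDeriv ℝ k (fun x => G (i + 1) x - G i x) x‖ ≤ b i * V (k + 1) := fun k i x _ => by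
    rw [norm_iteratedFDeriv_eq_norm_iteratedDeriv]
    exact hbound k i x
  have hcd : ContDiff ℝ ∞ fun x => ∑' n, (G (n + 1) x - G n x) :=
    contDiff_tsum (fun i => (hGc _).sub (hGc _)) (fun k _ => hvs k) hfb
  have hsumm : ∀ q x, Summable fun n => iteratedDeriv q (fun x => G (n + 1) x - G n x) x :=
    fun q x => Summable.of_norm_bounded (hvs q) fun n => hbound q n x
  have htsum : ∀ q x, iteratedDeriv q (fun x => ∑' n, (G (n + 1) x - G n x)) x =
      ∑' n, iteratedDeriv q (fun x => G (n + 1) x - G n x) x := by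
    intro q x
    simp only [iteratedDeriv_eq_iteratedFDeriv]
    rw [iteratedFDeriv_tsum (N := ⊤) (fun i => (hGc _).sub (hGc _)) (fun k _ => hvs k) hfb le_top]
    exact ContinuousLinearMap.map_tsum (ContinuousMultilinearMap.apply ℝ (fun _ : Fin q => ℝ) ℝ
        fun _ => (1 : ℝ)) (Summable.of_norm_bounded (hvs q) fun n => hfb q n x le_top)
  have hlim : ∀ q x, Filter.Tendsto (fun n => iteratedDeriv q (G n) x) Filter.atTop
      (nhds (iteratedDeriv q (fun x => g x + ∑' n, (G (n + 1) x - G n x)) x)) := by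
    intro q x
    have h2 : iteratedDeriv q (fun x => g x + ∑' n, (G (n + 1) x - G n x)) x = iteratedDeriv q g x +
        iteratedDeriv q (fun x => ∑' n, (G (n + 1) x - G n x)) x :=
      iteratedDeriv_add (hg.contDiffAt.of_le (mod_cast le_top))
        (hcd.contDiffAt.of_le (mod_cast le_top))
    rw [h2, htsum]
    have := ((hsumm q x).hasSum.tendsto_sum_nat).const_add (iteratedDeriv q g x)
    refine this.congr fun n => ?_
    simp only [hd]
    rw [Finset.sum_range_sub (fun n => iteratedDeriv q (G n) x)]
    simp [hG, iterAverage]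
  have hpart : ∀ n, ∑ j ∈ Finset.range n, b j ≤ r / 4 := fun n =>
    (hs.sum_le_tsum _ fun j _ => (hb j).le).trans hsum
  refine ⟨fun x => g x + ∑' n, (G (n + 1) x - G n x), hg.add hcd, fun x hx => ?_, fun x hx => ?_,
    fun q x => ?_⟩
  · refine tendsto_nhds_unique (hlim 0 x) (tendsto_const_nhds.congr fun n => ?_)
    rw [iteratedDeriv_zero, hG, iterAverage_const_left hb h0 n (by linarith [hpart n])]
  · refine tendsto_nhds_unique (hlim 0 x) (tendsto_const_nhds.congr fun n => ?_)
    rw [iteratedDeriv_zero, hG, iterAverage_const_right hb h1 n (by linarith [hpart n])]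
  · refine le_of_tendsto (hlim q x).abs ?_
    filter_upwards [Filter.eventually_ge_atTop q] with n hn
    exact abs_iteratedDeriv_iterAverage_le_prod hb hg hle n q hn x

end Cutoff

/-! ### Weight sequences -/

section Weights

/-- The quotient `M (p + 1) / M p`. -/
noncomputable def weightQuot (M : ℕ → ℝ) (p : ℕ) : ℝ := M (p + 1) / M p

/-- The properties of a weight sequence on which the extension rests, with one constant `a` for
all of them. They are invariant under `M k ↦ L ^ k * M k`, which makes the constants of the
extension independent of the scale `L`. -/
structure ScaleRegular (a : ℝ) (M : ℕ → ℝ) : Prop where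
  one_le : 1 ≤ a
  pos : ∀ k, 0 < M k
  zero : M 0 = 1
  mono : Monotone (weightQuot M)
  moderate : ∀ p, weightQuot M p ^ p ≤ a ^ p * M p
  scale : ∀ p : ℕ, (p + 2) / weightQuot M (p + 1) ≤ 2 * ((p + 1) / weightQuot M p)
  summable : Summable fun k => (weightQuot M k)⁻¹
  tail : ∀ p : ℕ, ∑' k, (weightQuot M (k + p))⁻¹ ≤ a * ((p + 1) / weightQuot M p)

theorem IsWeightSequence.exists_scaleRegular {M : ℕ → ℝ} (hM : IsWeightSequence M) :
    ∃ a, ScaleRegular a M := by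
  obtain ⟨hpos, h0, hlog, hquot, hsum, A, hA, -, hmod, htail⟩ := hM
  have hq : ∀ k, 0 < weightQuot M k := fun k => div_pos (hpos _) (hpos _)
  have hmono : Monotone (weightQuot M) := monotone_nat_of_le_succ fun k => by
    have := hlog (k + 1) (by omega)
    rw [Nat.add_sub_cancel] at this
    rw [weightQuot, weightQuot, div_le_div_iff₀ (hpos _) (hpos _)]
    nlinarith
  have hinv : ∀ k, (weightQuot M k)⁻¹ = M k / M (k + 1) := fun k => by rw [weightQuot, inv_div]
  have hs : Summable fun k => (weightQuot M k)⁻¹ := by simpa only [hinv] using hsum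
  have htail' : ∀ p : ℕ, 1 ≤ p → ∑' k, (weightQuot M (k + p))⁻¹ ≤ A * (p / weightQuot M p) := by
    intro p hp
    have := htail p hp
    simp only [hinv]
    convert this using 2
    · ext k; rw [add_comm p k]
    · rw [weightQuot]; have := hpos p; have := hpos (p + 1); field_simp
  refine ⟨A + 1, by linarith, hpos, h0, hmono, fun p => ?_, fun p => ?_, hs, fun p => ?_⟩
  · have h := hmod p
    have hAp : A ^ p ≤ (A + 1) ^ p := pow_le_pow_left₀ hA.le (by linarith) p
    refine le_trans ?_ (mul_le_mul_of_nonneg_right hAp (hpos p).le)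
    rw [weightQuot, div_pow, div_le_iff₀ (pow_pos (hpos p) p)]
    rw [pow_succ] at h
    linarith
  · rcases Nat.eq_zero_or_pos p with rfl | hp
    · have h01 := hmono (Nat.zero_le 1)
      have := one_div_le_one_div_of_le (hq 0) h01
      simp only [Nat.cast_zero, zero_add]
      rw [div_eq_mul_one_div]
      linarith
    · have h := hquot p hp
      have hp1 : (0 : ℝ) < p + 1 := by positivity
      have hp2 : (0 : ℝ) < p + 2 := by positivity
      have h' : weightQuot M p / (p + 1) ≤ weightQuot M (p + 1) / (p + 2) := by
        rw [weightQuot, weightQuot, div_div, div_div, mul_comm (M p), mul_comm (M (p + 1))]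
        exact h
      have hpos' : 0 < weightQuot M p / (p + 1) := div_pos (hq p) hp1
      have := inv_anti₀ hpos' h'
      rw [inv_div, inv_div] at this
      have h3 : 0 < ((p : ℝ) + 1) / weightQuot M p := div_pos hp1 (hq p)
      linarith
  · rcases Nat.eq_zero_or_pos p with rfl | hp
    · have h1 := htail' 1 le_rfl
      have h2 := hs.sum_add_tsum_nat_add 1
      simp only [Finset.sum_range_one] at h2
      have h01 := one_div_le_one_div_of_le (hq 0) (hmono (Nat.zero_le 1))
      simp only [add_zero, Nat.cast_zero, zero_add]
      rw [← h2]
      simp only [Nat.cast_one] at h1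
      have := mul_le_mul_of_nonneg_left h01 hA.le
      rw [inv_eq_one_div]
      linarith
    · refine (htail' p hp).trans ?_
      have := hq p
      gcongr <;> linarith

namespace ScaleRegular

variable {a : ℝ} {M : ℕ → ℝ}

theorem weightQuot_rescale {L : ℝ} (hL : 0 < L) (k : ℕ) :
    weightQuot (fun k => L ^ k * M k) k = L * weightQuot M k := by
  rw [weightQuot, weightQuot, pow_succ, mul_assoc, mul_div_mul_left _ _ (pow_pos hL k).ne',
    mul_div_assoc]

theorem rescale (h : ScaleRegular a M) {L : ℝ} (hL : 0 < L) :
    ScaleRegular a fun k => L ^ k * M k := by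
  have e : ∀ k, weightQuot (fun k => L ^ k * M k) k = L * weightQuot M k :=
    weightQuot_rescale hL
  refine ⟨h.one_le, fun k => mul_pos (pow_pos hL k) (h.pos k), by simp [h.zero],
    fun i j hij => ?_, fun p => ?_, fun p => ?_, ?_, fun p => ?_⟩
  · simp only [e]
    exact mul_le_mul_of_nonneg_left (h.mono hij) hL.le
  · rw [e, mul_pow]
    have := mul_le_mul_of_nonneg_left (h.moderate p) (pow_pos hL p).le
    linarith
  · rw [e, e]
    have := mul_le_mul_of_nonneg_left (h.scale p) (inv_pos.2 hL).le
    simp only [div_eq_mul_inv, mul_inv] at this ⊢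
    linarith
  · simp only [e, mul_inv]
    exact h.summable.mul_left _
  · simp only [e, mul_inv, tsum_mul_left]
    have := mul_le_mul_of_nonneg_left (h.tail p) (inv_pos.2 hL).le
    simp only [div_eq_mul_inv, mul_inv] at this ⊢
    linarith

theorem quot_pos (h : ScaleRegular a M) (k : ℕ) : 0 < weightQuot M k :=
  div_pos (h.pos _) (h.pos _)

theorem succ_eq (h : ScaleRegular a M) (k : ℕ) : M (k + 1) = weightQuot M k * M k := by
  rw [weightQuot, div_mul_cancel₀ _ (h.pos k).ne']

theorem mul_le (h : ScaleRegular a M) (i j : ℕ) : M i * M j ≤ M (i + j) := by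
  induction j with
  | zero => simp [h.zero]
  | succ j ih =>
    rw [← add_assoc, h.succ_eq, h.succ_eq, mul_left_comm]
    exact mul_le_mul (h.mono (by omega)) ih (mul_pos (h.pos _) (h.pos _)).le (h.quot_pos _).le

theorem prod_le (h : ScaleRegular a M) {ι : Type*} (s : Finset ι) (f : ι → ℕ) :
    ∏ i ∈ s, M (f i) ≤ M (∑ i ∈ s, f i) := by
  classical
  induction s using Finset.induction_on with
  | empty => simp [h.zero]
  | insert i s hi ih =>
    rw [Finset.prod_insert hi, Finset.sum_insert hi]
    exact (mul_le_mul_of_nonneg_left ih (h.pos _).le).trans (h.mul_le _ _)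

theorem le_mul_pow (h : ScaleRegular a M) {p : ℕ} (q k : ℕ) (hk : q + k ≤ p + 1) :
    M (q + k) ≤ M q * weightQuot M p ^ k := by
  induction k with
  | zero => simp
  | succ k ih =>
    rw [← add_assoc, h.succ_eq, pow_succ, ← mul_assoc, mul_comm]
    exact mul_le_mul (ih (by omega)) (h.mono (by omega)) (h.quot_pos _).le
      (mul_pos (h.pos _) (pow_pos (h.quot_pos _) _)).le

theorem prod_quot_le (h : ScaleRegular a M) (p q : ℕ) :
    ∏ j ∈ Finset.range q, weightQuot M (max j p) ≤ a ^ p * M q := by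
  have hmain : (∏ j ∈ Finset.range q, weightQuot M (max j p)) * M p ≤ weightQuot M p ^ p * M q := by
    rcases le_total q p with hq | hq
    · have : ∏ j ∈ Finset.range q, weightQuot M (max j p) = weightQuot M p ^ q := by
        rw [Finset.prod_congr rfl fun j hj => by
          rw [max_eq_right ((Finset.mem_range.1 hj).le.trans hq)]]
        simp
      rw [this]
      have h₁ := h.le_mul_pow (p := p) q (p - q) (by omega)
      rw [Nat.add_sub_cancel' hq] at h₁
      have h₂ := mul_le_mul_of_nonneg_left h₁ (pow_pos (h.quot_pos p) q).le
      refine h₂.trans (le_of_eq ?_)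
      rw [mul_left_comm, ← pow_add, Nat.add_sub_cancel' hq, mul_comm]
    · induction q, hq using Nat.le_induction with
      | base =>
        rw [Finset.prod_congr rfl fun j hj => by rw [max_eq_right (Finset.mem_range.1 hj).le]]
        simp
      | succ q hq ih =>
        rw [Finset.prod_range_succ, max_eq_left hq, h.succ_eq]
        have := mul_le_mul_of_nonneg_left ih (h.quot_pos q).le
        linarith
  have := hmain.trans (mul_le_mul_of_nonneg_right (h.moderate p) (h.pos q).le)
  refine le_of_mul_le_mul_right (this.trans (le_of_eq ?_)) (h.pos p)
  ring

/-- At the scale `κ (p + 1) / (M (p + 1) / M p)` attached to the order `p` there are smooth steps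
in the class of `M` whose bounds are only geometric in `p`. -/
theorem exists_step (h : ScaleRegular a M) {κ : ℝ} (hκ : 0 < κ) (p : ℕ) :
    ∃ g : ℝ → ℝ, ContDiff ℝ ∞ g ∧ (∀ x ≤ 0, g x = 0) ∧
      (∀ x, κ * ((p + 1) / weightQuot M p) ≤ x → g x = 1) ∧
      ∀ q x, |iteratedDeriv q g x| ≤ a ^ p * (4 * (a + 1) / κ) ^ q * M q := by
  have ha := h.one_le
  have hm := h.quot_pos
  set θ := κ / (4 * (a + 1)) with hθ
  have hθ0 : 0 < θ := by positivity
  have hs' : Summable fun j => (weightQuot M (max j p))⁻¹ := by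
    refine Summable.of_nonneg_of_le (fun j => (inv_pos.2 (hm _)).le) (fun j => ?_) h.summable
    exact inv_anti₀ (hm j) (h.mono (le_max_left j p))
  have htsum : ∑' j, (weightQuot M (max j p))⁻¹ ≤ (a + 1) * ((p + 1) / weightQuot M p) := by
    rw [← hs'.sum_add_tsum_nat_add p]
    have h₁ : ∑ j ∈ Finset.range p, (weightQuot M (max j p))⁻¹ = p / weightQuot M p := by
      rw [Finset.sum_congr rfl fun j hj => by rw [max_eq_right (Finset.mem_range.1 hj).le]]
      simp [div_eq_mul_inv]
    have h₂ : ∑' j, (weightQuot M (max (j + p) p))⁻¹ ≤ a * ((p + 1) / weightQuot M p) := by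
      simpa using h.tail p
    have h₃ : (p : ℝ) / weightQuot M p ≤ (p + 1) / weightQuot M p :=
      div_le_div_of_nonneg_right (by linarith) (hm p).le
    rw [h₁]
    linarith
  obtain ⟨g, hg, h0, h1, hb⟩ := exists_smooth_step
    (r := κ * ((p + 1) / weightQuot M p)) (b := fun j => θ * (weightQuot M (max j p))⁻¹)
    (mul_pos hκ (div_pos (by positivity) (hm p))) (fun j => mul_pos hθ0 (inv_pos.2 (hm _)))
    (hs'.mul_left θ) (by
      rw [tsum_mul_left]
      refine (mul_le_mul_of_nonneg_left htsum hθ0.le).trans (le_of_eq ?_)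
      rw [hθ]
      field_simp)
  refine ⟨g, hg, h0, h1, fun q x => (hb q x).trans ?_⟩
  have e : ∀ j, (θ * (weightQuot M (max j p))⁻¹)⁻¹ = 4 * (a + 1) / κ * weightQuot M (max j p) := by
    intro j
    rw [mul_inv, inv_inv, hθ, inv_div]
  simp only [e]
  rw [Finset.prod_mul_distrib, Finset.prod_const, Finset.card_range]
  have := mul_le_mul_of_nonneg_left (h.prod_quot_le p q)
    (by positivity : 0 ≤ (4 * (a + 1) / κ) ^ q)
  linarith

end ScaleRegular

end Weights

/-! ### Partitions of unity on grids -/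

section Grid

variable {d : ℕ}

theorem EuclideanSpace.norm_le_sum_abs (v : EuclideanSpace ℝ (Fin d)) : ‖v‖ ≤ ∑ i, |v i| := by
  rw [EuclideanSpace.norm_eq]
  refine Real.sqrt_le_iff.2 ⟨Finset.sum_nonneg fun i _ => abs_nonneg _, ?_⟩
  simp only [Real.norm_eq_abs]
  exact Finset.sum_sq_le_sq_sum_of_nonneg fun i _ => abs_nonneg (v i)

theorem EuclideanSpace.abs_apply_le_norm (v : EuclideanSpace ℝ (Fin d)) (i : Fin d) :
    |v i| ≤ ‖v‖ := PiLp.norm_apply_le v i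

/-- The difference of two neighbouring translates of the step `g`: the bump of the `n`-th cell of
the grid of width `r` with origin `o`. -/
def gridBump (g : ℝ → ℝ) (o r : ℝ) (n : ℕ) (t : ℝ) : ℝ :=
  g (t - (o + n * r)) - g (t - (o + (n + 1 : ℕ) * r))

variable {g : ℝ → ℝ} {o r : ℝ}

theorem contDiff_gridBump (hg : ContDiff ℝ ∞ g) (n : ℕ) : ContDiff ℝ ∞ (gridBump g o r n) :=
  (hg.comp (contDiff_id.sub contDiff_const)).sub (hg.comp (contDiff_id.sub contDiff_const))

theorem abs_iteratedDeriv_gridBump_le (hg : ContDiff ℝ ∞ g) {q : ℕ} {H : ℝ}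
    (hH : ∀ x, |iteratedDeriv q g x| ≤ H) (n : ℕ) (t : ℝ) :
    |iteratedDeriv q (gridBump g o r n) t| ≤ 2 * H := by
  have h : ∀ c : ℝ, ContDiff ℝ ∞ fun t => g (t - c) := fun c =>
    hg.comp (contDiff_id.sub contDiff_const)
  have e : iteratedDeriv q (gridBump g o r n) t =
      iteratedDeriv q (fun t => g (t - (o + n * r))) t -
      iteratedDeriv q (fun t => g (t - (o + (n + 1 : ℕ) * r))) t :=
    iteratedDeriv_sub ((h _).contDiffAt.of_le (mod_cast le_top))
      ((h _).contDiffAt.of_le (mod_cast le_top))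
  rw [e, iteratedDeriv_comp_sub_const, iteratedDeriv_comp_sub_const]
  refine (abs_sub _ _).trans ?_
  linarith [hH (t - (o + n * r)), hH (t - (o + (n + 1 : ℕ) * r))]

theorem sum_gridBump (N : ℕ) (t : ℝ) :
    ∑ n ∈ Finset.range N, gridBump g o r n t = g (t - o) - g (t - (o + N * r)) := by
  simp only [gridBump]
  rw [Finset.sum_range_sub' (fun n : ℕ => g (t - (o + n * r)))]
  simp

theorem iteratedDeriv_gridBump_eq_zero (hr : 0 < r) (h0 : ∀ x ≤ 0, g x = 0)
    (h1 : ∀ x, r ≤ x → g x = 1) (q n : ℕ) {t : ℝ}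
    (ht : ¬ (o + n * r ≤ t ∧ t ≤ o + (n + 2) * r)) :
    iteratedDeriv q (gridBump g o r n) t = 0 := by
  have hz : gridBump g o r n =ᶠ[nhds t] fun _ => (0 : ℝ) := by
    rw [not_and_or, not_le, not_le] at ht
    rcases ht with ht | ht
    · filter_upwards [Iio_mem_nhds ht] with y hy
      have hy : y < o + n * r := hy
      rw [gridBump, h0 _ (by linarith), h0 _ (by push_cast; nlinarith), sub_zero]
    · filter_upwards [Ioi_mem_nhds ht] with y hy
      have hy : o + (n + 2) * r < y := hy
      rw [gridBump, h1 _ (by nlinarith), h1 _ (by push_cast; nlinarith), sub_self]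
  rw [hz.iteratedDeriv_eq, iteratedDeriv_const]
  simp

theorem card_filter_gridBump_le (hr : 0 < r) (N : ℕ) (t : ℝ) :
    ((Finset.range N).filter fun n : ℕ => o + n * r ≤ t ∧ t ≤ o + (n + 2) * r).card ≤ 3 := by
  set s := (t - o) / r with hs
  have hsub : ((Finset.range N).filter fun n : ℕ => o + n * r ≤ t ∧ t ≤ o + (n + 2) * r) ⊆
      Finset.Icc (⌊s⌋₊ - 2) ⌊s⌋₊ := by
    intro n hn
    obtain ⟨-, h₁, h₂⟩ := Finset.mem_filter.1 hn
    have h₃ : (n : ℝ) ≤ s := by rw [hs, le_div_iff₀ hr]; linarith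
    have h₄ : s ≤ (n + 2 : ℕ) := by rw [hs, div_le_iff₀ hr]; push_cast; linarith
    have h₅ : ⌊s⌋₊ ≤ n + 2 := Nat.floor_le_of_le h₄
    exact Finset.mem_Icc.2 ⟨by omega, Nat.le_floor h₃⟩
  refine (Finset.card_le_card hsub).trans ?_
  rw [Nat.card_Icc]
  omega

/-- A partition of unity of a neighbourhood of `K`, made of translates of one bump over the cells
of a grid of width `r`, with a point of `K` near each cell. -/
theorem exists_grid_partition {K : Set (EuclideanSpace ℝ (Fin d))} (hK : Bornology.IsBounded K)
    (hr : 0 < r) (hg : ContDiff ℝ ∞ g) (h0 : ∀ x ≤ 0, g x = 0) (h1 : ∀ x, r ≤ x → g x = 1) :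
    ∃ (I : Finset (Fin d → ℕ)) (Ψ : (Fin d → ℕ) → EuclideanSpace ℝ (Fin d) → ℝ)
      (pt : (Fin d → ℕ) → EuclideanSpace ℝ (Fin d)),
      (∀ k ∈ I, pt k ∈ K) ∧ (∀ k, ContDiff ℝ ∞ (Ψ k)) ∧
      (∀ z, ∃ S ⊆ I, S.card ≤ 3 ^ d ∧
        (∀ k ∈ I, k ∉ S → ∀ w, dirWord (stdDir d) w (Ψ k) z = 0) ∧
        ∀ k ∈ S, ‖z - pt k‖ ≤ (4 * d + 1) * r) ∧
      (∀ x ∈ K, ∀ᶠ z in nhds x, ∑ k ∈ I, Ψ k z = 1) ∧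
      ∀ H : ℕ → ℝ, (∀ q x, |iteratedDeriv q g x| ≤ H q) → ∀ k w z,
        |dirWord (stdDir d) w (Ψ k) z| ≤ ∏ i, (2 * H (w.count i)) := by
  classical
  obtain ⟨R, hR⟩ := hK.subset_closedBall 0
  set R' := max R 0
  -- The grid starts at distance `2 r` outside a box that contains `K`.
  set o : ℝ := -(R' + 2 * r) with ho
  obtain ⟨N, hN⟩ := exists_nat_ge ((2 * R' + 3 * r) / r)
  rw [div_le_iff₀ hr] at hN
  set corner : (Fin d → ℕ) → EuclideanSpace ℝ (Fin d) :=
    fun k => WithLp.toLp 2 fun j => o + k j * r with hcorner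
  set near : (Fin d → ℕ) → Prop := fun k => ∃ x ∈ K, ‖x - corner k‖ ≤ (2 * d + 1) * r with hnear
  set box : Finset (Fin d → ℕ) := Fintype.piFinset fun _ => Finset.range N with hbox
  set Ψ : (Fin d → ℕ) → EuclideanSpace ℝ (Fin d) → ℝ :=
    fun k => tensorFun fun j => gridBump g o r (k j) with hΨ
  set inCell : (Fin d → ℕ) → EuclideanSpace ℝ (Fin d) → Prop :=
    fun k z => ∀ j, o + k j * r ≤ z j ∧ z j ≤ o + (k j + 2) * r with hinCell
  have hzero : ∀ k z, ¬ inCell k z → ∀ w, dirWord (stdDir d) w (Ψ k) z = 0 := by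
    intro k z hz w
    obtain ⟨j, hj⟩ := not_forall.1 hz
    rw [hΨ, dirWord_tensorFun fun j => contDiff_gridBump hg _]
    exact Finset.prod_eq_zero (Finset.mem_univ j) (iteratedDeriv_gridBump_eq_zero hr h0 h1 _ _ hj)
  have hdist : ∀ k z, inCell k z → ‖z - corner k‖ ≤ 2 * d * r := by
    intro k z hz
    refine (EuclideanSpace.norm_le_sum_abs _).trans ?_
    refine (Finset.sum_le_card_nsmul _ _ (2 * r) fun j _ => ?_).trans (le_of_eq ?_)
    · have := hz j
      have e : (z - corner k) j = z j - (o + k j * r) := rfl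
      rw [e, abs_le]
      constructor <;> linarith
    · simp; ring
  choose! pt hptK hpt using fun k (hk : near k) => hk
  refine ⟨box.filter near, Ψ, pt, fun k hk => hptK k (Finset.mem_filter.1 hk).2,
    fun k => contDiff_tensorFun fun j => contDiff_gridBump hg _, fun z => ?_, fun x hx => ?_,
    fun H hH k w z => ?_⟩
  · refine ⟨(box.filter near).filter fun k => inCell k z, Finset.filter_subset _ _, ?_,
      fun k hk hkS => hzero k z fun h => hkS (Finset.mem_filter.2 ⟨hk, h⟩), fun k hk => ?_⟩
    · have hsub : ((box.filter near).filter fun k => inCell k z) ⊆ Fintype.piFinset fun j =>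
          (Finset.range N).filter fun n : ℕ => o + n * r ≤ z j ∧ z j ≤ o + (n + 2) * r := by
        intro k hk
        rw [Finset.mem_filter, Finset.mem_filter, hbox, Fintype.mem_piFinset] at hk
        exact Fintype.mem_piFinset.2 fun j => Finset.mem_filter.2 ⟨hk.1.1 j, hk.2 j⟩
      refine (Finset.card_le_card hsub).trans ?_
      rw [Fintype.card_piFinset]
      refine (Finset.prod_le_pow_card _ _ 3 fun j _ => card_filter_gridBump_le hr N (z j)).trans ?_
      simp
    · rw [Finset.mem_filter, Finset.mem_filter] at hk
      have h₁ := hdist k z hk.2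
      have h₂ := hpt k hk.1.2
      have h₃ := norm_sub_le_norm_sub_add_norm_sub z (corner k) (pt k)
      rw [norm_sub_rev (corner k)] at h₃
      linarith
  · filter_upwards [Metric.ball_mem_nhds x hr] with z hz
    rw [mem_ball_iff_norm] at hz
    have hbig : ∑ k ∈ box.filter near, Ψ k z = ∑ k ∈ box, Ψ k z := by
      refine Finset.sum_subset (Finset.filter_subset _ _) fun k hk hk' => ?_
      refine hzero k z (fun hcell => hk' (Finset.mem_filter.2 ⟨hk, x, hx, ?_⟩)) []
      have h₁ := hdist k z hcell
      have h₂ := norm_sub_le_norm_sub_add_norm_sub x z (corner k)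
      rw [norm_sub_rev x z] at h₂
      linarith
    rw [hbig, hΨ]
    simp only [tensorFun]
    rw [← Finset.prod_univ_sum (fun _ => Finset.range N) fun j n => gridBump g o r n (z j)]
    refine Finset.prod_eq_one fun j _ => ?_
    have hxj : |x j| ≤ R' := (EuclideanSpace.abs_apply_le_norm x j).trans
      ((mem_closedBall_zero_iff.1 (hR hx)).trans (le_max_left _ _))
    have hzj : |z j - x j| ≤ ‖z - x‖ := EuclideanSpace.abs_apply_le_norm (z - x) j
    rw [abs_le] at hxj hzj
    rw [sum_gridBump, h1 _ (by rw [ho]; linarith), h0 _ (by rw [ho]; linarith), sub_zero]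
  · rw [hΨ, dirWord_tensorFun fun j => contDiff_gridBump hg _, tensorFun, Finset.abs_prod]
    exact Finset.prod_le_prod (fun _ _ => abs_nonneg _) fun j _ =>
      abs_iteratedDeriv_gridBump_le hg (hH _) _ _

end Grid

/-! ### Taylor polynomials of jets -/

section Taylor

variable {d : ℕ}

/-- The divided power `v ^ δ / δ!`. -/
noncomputable def divPow (δ : Fin d → ℕ) (v : EuclideanSpace ℝ (Fin d)) : ℝ :=
  ∏ i, v i ^ δ i / ((δ i)! : ℝ)

/-- The Taylor polynomial of degree `m` at `x` of the derivative of order `α` of the jet `c`. -/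
noncomputable def jetPoly (c : (Fin d → ℕ) → EuclideanSpace ℝ (Fin d) → ℝ) (m : ℕ) (α : Fin d → ℕ)
    (x z : EuclideanSpace ℝ (Fin d)) : ℝ :=
  ∑ j ∈ Finset.range (m + 1), ∑ δ ∈ Finset.piAntidiag (Finset.univ : Finset (Fin d)) j,
    c (α + δ) x * divPow δ (z - x)

theorem div_miFactorial_mul_miPow (t : ℝ) (δ : Fin d → ℕ) (v : EuclideanSpace ℝ (Fin d)) :
    t / (miFactorial δ : ℝ) * miPow v δ = t * divPow δ v := by
  rw [divPow, Finset.prod_div_distrib, miFactorial, miPow]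
  push_cast
  ring

theorem mem_piAntidiag_univ {δ : Fin d → ℕ} {j : ℕ} :
    δ ∈ Finset.piAntidiag (Finset.univ : Finset (Fin d)) j ↔ miOrder δ = j := by
  simp [Finset.mem_piAntidiag, miOrder]

theorem miOrder_add (α β : Fin d → ℕ) : miOrder (α + β) = miOrder α + miOrder β := by
  simp [miOrder, Finset.sum_add_distrib]

theorem miOrder_single (i : Fin d) : miOrder (Pi.single i 1 : Fin d → ℕ) = 1 := by
  simp [miOrder]

theorem miOrder_count (w : List (Fin d)) : (miOrder fun i => w.count i) = w.length :=
  (length_eq_sum_count w).symm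

theorem divPow_sub_eq_tensorFun (δ : Fin d → ℕ) (x : EuclideanSpace ℝ (Fin d)) :
    (fun z => divPow δ (z - x)) = tensorFun fun j t => (t - x j) ^ δ j / ((δ j)! : ℝ) := rfl

theorem contDiff_divPow_sub (δ : Fin d → ℕ) (x : EuclideanSpace ℝ (Fin d)) :
    ContDiff ℝ ∞ fun z => divPow δ (z - x) := by
  rw [divPow_sub_eq_tensorFun]
  exact contDiff_tensorFun fun j => by fun_prop

theorem contDiff_jetPoly (c : (Fin d → ℕ) → EuclideanSpace ℝ (Fin d) → ℝ) (m : ℕ) (α : Fin d → ℕ)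
    (x : EuclideanSpace ℝ (Fin d)) : ContDiff ℝ ∞ (jetPoly c m α x) := by
  unfold jetPoly
  exact ContDiff.sum fun j _ => ContDiff.sum fun δ _ =>
    contDiff_const.mul (contDiff_divPow_sub δ x)

theorem deriv_sub_pow_div_factorial (k : ℕ) (a : ℝ) :
    deriv (fun t : ℝ => (t - a) ^ (k + 1) / ((k + 1)! : ℝ)) =
      fun t : ℝ => (t - a) ^ k / (k ! : ℝ) := by
  funext t
  have h := (((hasDerivAt_id t).sub_const a).pow (k + 1)).div_const ((k + 1)! : ℝ)
  refine h.deriv.trans ?_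
  have : (k ! : ℝ) ≠ 0 := by positivity
  simp only [id, Nat.factorial_succ, Nat.add_sub_cancel]
  push_cast
  field_simp

theorem fderiv_divPow_sub_add_single (δ : Fin d → ℕ) (x z : EuclideanSpace ℝ (Fin d)) (i : Fin d) :
    fderiv ℝ (fun z => divPow (δ + Pi.single i 1) (z - x)) z (stdDir d i) = divPow δ (z - x) := by
  rw [divPow_sub_eq_tensorFun, fderiv_tensorFun fun j => by fun_prop]
  refine Finset.prod_congr rfl fun j _ => ?_
  by_cases h : j = i
  · subst h
    simp only [Function.update_self, Pi.add_apply, Pi.single_eq_same]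
    rw [deriv_sub_pow_div_factorial]
    rfl
  · simp [h]

theorem fderiv_divPow_sub_of_eq_zero {δ : Fin d → ℕ} {i : Fin d} (h : δ i = 0)
    (x z : EuclideanSpace ℝ (Fin d)) :
    fderiv ℝ (fun z => divPow δ (z - x)) z (stdDir d i) = 0 := by
  rw [divPow_sub_eq_tensorFun, fderiv_tensorFun fun j => by fun_prop]
  exact Finset.prod_eq_zero (Finset.mem_univ i) (by simp [h])

theorem fderiv_jetPoly (c : (Fin d → ℕ) → EuclideanSpace ℝ (Fin d) → ℝ) (m : ℕ) (α : Fin d → ℕ)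
    (x z : EuclideanSpace ℝ (Fin d)) (i : Fin d) :
    fderiv ℝ (jetPoly c m α x) z (stdDir d i) =
      ∑ j ∈ Finset.range m, ∑ δ ∈ Finset.piAntidiag (Finset.univ : Finset (Fin d)) j,
        c (α + Pi.single i 1 + δ) x * divPow δ (z - x) := by
  have hd : ∀ δ, DifferentiableAt ℝ (fun z => divPow δ (z - x)) z := fun δ =>
    (contDiff_divPow_sub δ x).differentiable_infty.differentiableAt
  have h₁ : fderiv ℝ (jetPoly c m α x) z (stdDir d i) =
      ∑ j ∈ Finset.range (m + 1), ∑ δ ∈ Finset.piAntidiag (Finset.univ : Finset (Fin d)) j,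
        c (α + δ) x * fderiv ℝ (fun z => divPow δ (z - x)) z (stdDir d i) := by
    unfold jetPoly
    rw [fderiv_fun_sum fun j _ => DifferentiableAt.fun_sum fun δ _ => (hd δ).const_mul _, sum_apply]
    refine Finset.sum_congr rfl fun j _ => ?_
    rw [fderiv_fun_sum fun δ _ => (hd δ).const_mul _, sum_apply]
    refine Finset.sum_congr rfl fun δ _ => ?_
    rw [fderiv_const_mul (hd δ)]
    rfl
  rw [h₁, Finset.sum_range_succ']
  have h₂ : ∑ δ ∈ Finset.piAntidiag (Finset.univ : Finset (Fin d)) 0,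
      c (α + δ) x * fderiv ℝ (fun z => divPow δ (z - x)) z (stdDir d i) = 0 := by
    refine Finset.sum_eq_zero fun δ hδ => ?_
    rw [mem_piAntidiag_univ, miOrder, Finset.sum_eq_zero_iff] at hδ
    rw [fderiv_divPow_sub_of_eq_zero (hδ i (Finset.mem_univ i)), mul_zero]
  rw [h₂, add_zero]
  refine Finset.sum_congr rfl fun j _ => (Finset.sum_of_injOn (fun δ => δ + Pi.single i 1)
    (fun δ _ δ' _ h => add_right_cancel h) (fun δ hδ => ?_) (fun δ hδ hδ' => ?_)
    fun δ _ => ?_).symm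
  · rw [Finset.mem_coe, mem_piAntidiag_univ] at hδ ⊢
    rw [miOrder_add, miOrder_single, hδ]
  · rw [fderiv_divPow_sub_of_eq_zero, mul_zero]
    by_contra hi
    have hle : Pi.single i 1 ≤ δ := by
      intro j
      by_cases h : j = i
      · subst h
        simpa [Nat.one_le_iff_ne_zero] using hi
      · simp [h]
    refine hδ' ⟨δ - Pi.single i 1, ?_, tsub_add_cancel_of_le hle⟩
    · have e := congrArg miOrder (tsub_add_cancel_of_le hle)
      rw [miOrder_add, miOrder_single, mem_piAntidiag_univ.1 hδ] at e
      rw [Finset.mem_coe, mem_piAntidiag_univ]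
      omega
  · rw [fderiv_divPow_sub_add_single, add_right_comm, ← add_assoc]

theorem dirWord_jetPoly (c : (Fin d → ℕ) → EuclideanSpace ℝ (Fin d) → ℝ) (n : ℕ)
    (x z : EuclideanSpace ℝ (Fin d)) (w : List (Fin d)) :
    dirWord (stdDir d) w (jetPoly c n 0 x) z =
      if w.length ≤ n then jetPoly c (n - w.length) (fun i => w.count i) x z else 0 := by
  have := dirWord_eqOn (stdDir d) isOpen_univ
    (fun (α : Fin d → ℕ) z => if miOrder α ≤ n then jetPoly c (n - miOrder α) α x z else 0)
    (fun i α => α + Pi.single i 1) (fun i α z _ => by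
      simp only [miOrder_add, miOrder_single]
      by_cases h : miOrder α ≤ n
      · simp only [h, if_true]
        rw [fderiv_jetPoly]
        by_cases h' : miOrder α + 1 ≤ n
        · rw [if_pos h', jetPoly, show n - (miOrder α + 1) + 1 = n - miOrder α by omega]
        · rw [if_neg h', show n - miOrder α = 0 by omega]
          simp
      · rw [if_neg (by omega)]
        simp [h])
    (f := jetPoly c n 0 x) (a := 0) (fun z _ => by simp [miOrder]) w (Set.mem_univ z)
  rw [this, foldr_add_single, zero_add, miOrder_count]

theorem sum_abs_divPow_le (j : ℕ) (v : EuclideanSpace ℝ (Fin d)) {ρ : ℝ} (hv : ‖v‖ ≤ ρ) :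
    ∑ δ ∈ Finset.piAntidiag (Finset.univ : Finset (Fin d)) j, |divPow δ v| ≤
      (d * ρ) ^ j / (j ! : ℝ) := by
  have h₁ : ∑ δ ∈ Finset.piAntidiag (Finset.univ : Finset (Fin d)) j, |divPow δ v| =
      (∑ i, |v i|) ^ j / (j ! : ℝ) := by
    rw [Finset.sum_pow_eq_sum_piAntidiag, Finset.sum_div]
    refine Finset.sum_congr rfl fun δ hδ => ?_
    have hs := Nat.multinomial_spec Finset.univ δ
    have hj : ∑ i, δ i = j := mem_piAntidiag_univ.1 hδ
    rw [hj] at hs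
    have hs' : (∏ i, ((δ i)! : ℝ)) * (Nat.multinomial Finset.univ δ : ℝ) = (j ! : ℝ) := by
      exact_mod_cast hs
    rw [divPow, Finset.prod_div_distrib, abs_div, Finset.abs_prod,
      abs_of_pos (Finset.prod_pos fun i _ => by positivity), ← hs']
    have h₁ : (∏ i, ((δ i)! : ℝ)) ≠ 0 := (Finset.prod_pos fun i _ => by positivity).ne'
    have h₂ : (Nat.multinomial Finset.univ δ : ℝ) ≠ 0 := by
      intro h
      rw [h, mul_zero] at hs'
      exact (by positivity : (j ! : ℝ) ≠ 0) hs'.symm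
    simp only [abs_pow]
    field_simp
  rw [h₁]
  have h₂ : ∑ i, |v i| ≤ d * ρ := by
    refine (Finset.sum_le_card_nsmul _ _ ρ fun i _ =>
      (EuclideanSpace.abs_apply_le_norm v i).trans hv).trans (le_of_eq (by simp))
  have h₃ : 0 ≤ ∑ i, |v i| := Finset.sum_nonneg fun i _ => abs_nonneg _
  gcongr

theorem add_pow_div_factorial (s t : ℝ) (k : ℕ) :
    (s + t) ^ k / (k ! : ℝ) =
      ∑ p ∈ Finset.HasAntidiagonal.antidiagonal k,
        s ^ p.1 / (p.1 ! : ℝ) * (t ^ p.2 / (p.2 ! : ℝ)) := by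
  rw [add_pow, Finset.sum_div, Finset.Nat.sum_antidiagonal_eq_sum_range_succ_mk
    (fun p : ℕ × ℕ => s ^ p.1 / (p.1 ! : ℝ) * (t ^ p.2 / (p.2 ! : ℝ)))]
  refine Finset.sum_congr rfl fun i hi => ?_
  have hi' : i ≤ k := Nat.lt_succ_iff.1 (Finset.mem_range.1 hi)
  rw [Nat.cast_choose ℝ hi']
  field_simp

theorem divPow_add (γ : Fin d → ℕ) (u v : EuclideanSpace ℝ (Fin d)) :
    divPow γ (u + v) = ∑ p ∈ Fintype.piFinset fun i => Finset.HasAntidiagonal.antidiagonal (γ i),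
      divPow (fun i => (p i).1) u * divPow (fun i => (p i).2) v := by
  simp only [divPow, PiLp.add_apply, add_pow_div_factorial]
  rw [Finset.prod_univ_sum]
  simp only [Finset.prod_mul_distrib]

/-- The multi-indices of order at most `m`. -/
def miLE (d m : ℕ) : Finset (Fin d → ℕ) :=
  (Finset.range (m + 1)).biUnion fun j => Finset.piAntidiag (Finset.univ : Finset (Fin d)) j

theorem mem_miLE {m : ℕ} {δ : Fin d → ℕ} : δ ∈ miLE d m ↔ miOrder δ ≤ m := by
  simp only [miLE, Finset.mem_biUnion, mem_piAntidiag_univ, Finset.mem_range]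
  constructor
  · rintro ⟨j, hj, rfl⟩; omega
  · intro h; exact ⟨_, by omega, rfl⟩

theorem sum_miLE (m : ℕ) (f : ℕ → (Fin d → ℕ) → ℝ) :
    ∑ j ∈ Finset.range (m + 1), ∑ δ ∈ Finset.piAntidiag (Finset.univ : Finset (Fin d)) j, f j δ =
      ∑ δ ∈ miLE d m, f (miOrder δ) δ := by
  rw [miLE, Finset.sum_biUnion]
  · refine Finset.sum_congr rfl fun j _ => Finset.sum_congr rfl fun δ hδ => ?_
    rw [mem_piAntidiag_univ.1 hδ]
  · intro i _ j _ hij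
    rw [Function.onFun, Finset.disjoint_left]
    intro δ hi hj
    exact hij ((mem_piAntidiag_univ.1 hi).symm.trans (mem_piAntidiag_univ.1 hj))

/-- Taylor's formula: the Taylor polynomial at `x'`, expanded at `x`. -/
theorem jetPoly_expand (c : (Fin d → ℕ) → EuclideanSpace ℝ (Fin d) → ℝ) (m : ℕ) (α : Fin d → ℕ)
    (x x' z : EuclideanSpace ℝ (Fin d)) :
    jetPoly c m α x' z =
      ∑ j ∈ Finset.range (m + 1), ∑ δ ∈ Finset.piAntidiag (Finset.univ : Finset (Fin d)) j,
        jetPoly c (m - j) (α + δ) x' x * divPow δ (z - x) := by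
  rw [sum_miLE m fun j δ => jetPoly c (m - j) (α + δ) x' x * divPow δ (z - x)]
  simp only [jetPoly, sum_miLE _ fun _ δ => c (_ + δ) x' * divPow δ _]
  have hz : z - x' = (z - x) + (x - x') := by abel
  simp only [hz, divPow_add, Finset.mul_sum, Finset.sum_mul]
  rw [Finset.sum_sigma', Finset.sum_sigma']
  refine Finset.sum_bij' (fun q _ => ⟨fun i => (q.2 i).1, fun i => (q.2 i).2⟩)
    (fun q _ => ⟨q.1 + q.2, fun i => (q.1 i, q.2 i)⟩) ?_ ?_ ?_ ?_ ?_
  · rintro ⟨γ, p⟩ h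
    simp only [Finset.mem_sigma, mem_miLE, Fintype.mem_piFinset,
      Finset.HasAntidiagonal.mem_antidiagonal] at h ⊢
    have e : γ = (fun i => (p i).1) + fun i => (p i).2 := funext fun i => (h.2 i).symm
    have := h.1
    rw [e, miOrder_add] at this
    omega
  · rintro ⟨δ, ε⟩ h
    simp only [Finset.mem_sigma, mem_miLE, Fintype.mem_piFinset,
      Finset.HasAntidiagonal.mem_antidiagonal, miOrder_add, Pi.add_apply, implies_true, and_true] at h ⊢
    omega
  · rintro ⟨γ, p⟩ h
    simp only [Finset.mem_sigma, mem_miLE, Fintype.mem_piFinset,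
      Finset.HasAntidiagonal.mem_antidiagonal] at h
    have e : γ = (fun i => (p i).1) + fun i => (p i).2 := funext fun i => (h.2 i).symm
    subst e
    rfl
  · rintro ⟨δ, ε⟩ h
    rfl
  · rintro ⟨γ, p⟩ h
    simp only [Finset.mem_sigma, mem_miLE, Fintype.mem_piFinset,
      Finset.HasAntidiagonal.mem_antidiagonal] at h
    have e : γ = (fun i => (p i).1) + fun i => (p i).2 := funext fun i => (h.2 i).symm
    simp only [add_assoc, ← e]
    ring

end Taylor

/-! ### Estimates for the Taylor polynomials of Whitney jets -/

section Estimates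

variable {d : ℕ} {K : Set (EuclideanSpace ℝ (Fin d))} {M : ℕ → ℝ} {B : ℝ}
  {c : (Fin d → ℕ) → EuclideanSpace ℝ (Fin d) → ℝ}

/-- A jet on `K` in the class of `M`, with bound `B` on its entries and on its Taylor
remainders. -/
structure WhitneyJet (K : Set (EuclideanSpace ℝ (Fin d))) (M : ℕ → ℝ) (B : ℝ)
    (c : (Fin d → ℕ) → EuclideanSpace ℝ (Fin d) → ℝ) : Prop where
  nonneg : 0 ≤ B
  bound : ∀ α, ∀ x ∈ K, |c α x| ≤ B * M (miOrder α)
  remainder : ∀ n α, miOrder α ≤ n → ∀ x ∈ K, ∀ z ∈ K,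
    |c α z - jetPoly c (n - miOrder α) α x z| ≤
      B * M (n + 1) * (‖z - x‖ ^ (n - miOrder α + 1) / ((n - miOrder α + 1)! : ℝ))

theorem sum_pow_div_factorial_le {s t : ℝ} (hs : 0 ≤ s) (ht : 0 ≤ t) (m : ℕ) :
    ∑ j ∈ Finset.range (m + 1),
        s ^ (m - j + 1) / ((m - j + 1)! : ℝ) * (t ^ j / (j ! : ℝ)) ≤
      (t + s) ^ (m + 1) / ((m + 1)! : ℝ) := by
  rw [add_pow_div_factorial, Finset.Nat.sum_antidiagonal_eq_sum_range_succ_mk,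
    Finset.sum_range_succ _ (m + 1)]
  refine le_trans (le_of_eq (Finset.sum_congr rfl fun j hj => ?_))
    (le_add_of_nonneg_right (by positivity))
  have : m + 1 - j = m - j + 1 := by have := Finset.mem_range.1 hj; omega
  rw [this, mul_comm]

namespace WhitneyJet

/-- Two Taylor polynomials of the same order at nearby points differ by little: their difference
is the sum of the remainders at one of the points. -/
theorem abs_dirWord_jetPoly_sub_le (h : WhitneyJet K M B c) (hM : ∀ k, 0 < M k) {p : ℕ}
    {x x' z : EuclideanSpace ℝ (Fin d)} (hx : x ∈ K) (hx' : x' ∈ K) {ρ : ℝ} (hz : ‖z - x‖ ≤ ρ)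
    (hz' : ‖z - x'‖ ≤ ρ) (w : List (Fin d)) (hw : w.length ≤ p) :
    |dirWord (stdDir d) w (jetPoly c p 0 x) z - dirWord (stdDir d) w (jetPoly c p 0 x') z| ≤
      B * M (p + 1) * (((d + 2) * ρ) ^ (p + 1 - w.length) / ((p + 1 - w.length)! : ℝ)) := by
  have hρ : 0 ≤ ρ := (norm_nonneg _).trans hz
  have hB := h.nonneg
  have hMp := hM (p + 1)
  have hxx' : ‖x - x'‖ ≤ 2 * ρ := by
    have := norm_sub_le_norm_sub_add_norm_sub x z x'
    rw [norm_sub_rev x z] at this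
    linarith
  obtain ⟨m, rfl⟩ := Nat.exists_eq_add_of_le hw
  set α : Fin d → ℕ := fun i => w.count i with hα
  have hαo : miOrder α = w.length := miOrder_count w
  rw [dirWord_jetPoly, dirWord_jetPoly, if_pos hw, if_pos hw, Nat.add_sub_cancel_left,
    jetPoly_expand c m _ x x' z, jetPoly, ← Finset.sum_sub_distrib,
    show w.length + m + 1 - w.length = m + 1 by omega]
  have hterm : ∀ j ∈ Finset.range (m + 1),
      |∑ δ ∈ Finset.piAntidiag (Finset.univ : Finset (Fin d)) j, c (α + δ) x * divPow δ (z - x) -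
        ∑ δ ∈ Finset.piAntidiag (Finset.univ : Finset (Fin d)) j,
          jetPoly c (m - j) (α + δ) x' x * divPow δ (z - x)| ≤
      B * M (w.length + m + 1) * ((2 * ρ) ^ (m - j + 1) / ((m - j + 1)! : ℝ) *
        ((d * ρ) ^ j / (j ! : ℝ))) := by
    intro j hj
    have hj' : j ≤ m := Nat.lt_succ_iff.1 (Finset.mem_range.1 hj)
    rw [← Finset.sum_sub_distrib]
    refine (Finset.abs_sum_le_sum_abs _ _).trans ?_
    have hδ : ∀ δ ∈ Finset.piAntidiag (Finset.univ : Finset (Fin d)) j,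
        |c (α + δ) x * divPow δ (z - x) - jetPoly c (m - j) (α + δ) x' x * divPow δ (z - x)| ≤
          B * M (w.length + m + 1) * ((2 * ρ) ^ (m - j + 1) / ((m - j + 1)! : ℝ)) *
            |divPow δ (z - x)| := by
      intro δ hδ
      rw [← sub_mul, abs_mul]
      refine mul_le_mul_of_nonneg_right ?_ (abs_nonneg _)
      have ho : miOrder (α + δ) = w.length + j := by
        rw [miOrder_add, hαo, mem_piAntidiag_univ.1 hδ]
      have hr := h.remainder (w.length + m) (α + δ) (by omega) x' hx' x hx
      rw [ho, show w.length + m - (w.length + j) = m - j by omega] at hr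
      refine hr.trans ?_
      gcongr
    refine (Finset.sum_le_sum hδ).trans ?_
    rw [← Finset.mul_sum, ← mul_assoc]
    exact mul_le_mul_of_nonneg_left (sum_abs_divPow_le j _ hz) (by positivity)
  refine (Finset.abs_sum_le_sum_abs _ _).trans ((Finset.sum_le_sum hterm).trans ?_)
  rw [← Finset.mul_sum]
  refine mul_le_mul_of_nonneg_left ?_ (by positivity)
  refine (sum_pow_div_factorial_le (by positivity) (by positivity) m).trans (le_of_eq ?_)
  rw [add_mul]

theorem abs_dirWord_jetPoly_succ_sub_le (h : WhitneyJet K M B c) (hM : ∀ k, 0 < M k) {p : ℕ}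
    {x z : EuclideanSpace ℝ (Fin d)} (hx : x ∈ K) {ρ : ℝ} (hz : ‖z - x‖ ≤ ρ)
    (w : List (Fin d)) (hw : w.length ≤ p + 1) :
    |dirWord (stdDir d) w (jetPoly c (p + 1) 0 x) z - dirWord (stdDir d) w (jetPoly c p 0 x) z| ≤
      B * M (p + 1) * (((d + 2) * ρ) ^ (p + 1 - w.length) / ((p + 1 - w.length)! : ℝ)) := by
  have hρ : 0 ≤ ρ := (norm_nonneg _).trans hz
  have hB := h.nonneg
  have hMp := hM (p + 1)
  set α : Fin d → ℕ := fun i => w.count i with hα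
  have hαo : miOrder α = w.length := miOrder_count w
  have e : dirWord (stdDir d) w (jetPoly c (p + 1) 0 x) z -
      dirWord (stdDir d) w (jetPoly c p 0 x) z =
      ∑ δ ∈ Finset.piAntidiag (Finset.univ : Finset (Fin d)) (p + 1 - w.length),
        c (α + δ) x * divPow δ (z - x) := by
    rw [dirWord_jetPoly, dirWord_jetPoly, if_pos hw]
    by_cases hw' : w.length ≤ p
    · rw [if_pos hw', jetPoly, jetPoly, Finset.sum_range_succ,
        show p + 1 - w.length = p - w.length + 1 by omega, add_sub_cancel_left]
    · rw [if_neg hw', show p + 1 - w.length = 0 by omega, jetPoly, Finset.sum_range_one, sub_zero]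
  rw [e]
  refine (Finset.abs_sum_le_sum_abs _ _).trans ?_
  have hδ : ∀ δ ∈ Finset.piAntidiag (Finset.univ : Finset (Fin d)) (p + 1 - w.length),
      |c (α + δ) x * divPow δ (z - x)| ≤ B * M (p + 1) * |divPow δ (z - x)| := by
    intro δ hδ
    rw [abs_mul]
    refine mul_le_mul_of_nonneg_right ((h.bound _ x hx).trans (le_of_eq ?_)) (abs_nonneg _)
    rw [miOrder_add, hαo, mem_piAntidiag_univ.1 hδ, Nat.add_sub_cancel' hw]
  refine (Finset.sum_le_sum hδ).trans ?_
  rw [← Finset.mul_sum]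
  refine mul_le_mul_of_nonneg_left ((sum_abs_divPow_le _ _ hz).trans ?_) (by positivity)
  gcongr
  linarith

end WhitneyJet

theorem pow_div_factorial_le_three_pow (n k : ℕ) : (n : ℝ) ^ k / (k ! : ℝ) ≤ 3 ^ n := by
  refine (Real.pow_div_factorial_le_exp n (Nat.cast_nonneg n) k).trans ?_
  rw [← mul_one (n : ℝ), Real.exp_nat_mul]
  exact pow_le_pow_left₀ (Real.exp_pos 1).le (by linarith [Real.exp_one_lt_d9]) n

/-- At the scale of the order `p`, a remainder of order `p` is geometrically small in the class
of `M`. -/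
theorem ScaleRegular.mul_pow_div_factorial_le {a : ℝ} (hM : ScaleRegular a M) {s : ℝ} (hs : 0 < s)
    {p q : ℕ} (hq : q ≤ p + 1) :
    M (p + 1) * ((s * ((p + 1) / weightQuot M p)) ^ (p + 1 - q) / ((p + 1 - q)! : ℝ)) ≤
      (3 * s) ^ (p + 1) * (s⁻¹ ^ q * M q) := by
  obtain ⟨k, hk⟩ := Nat.exists_eq_add_of_le hq
  have hkq : p + 1 - q = k := by omega
  have hm := hM.quot_pos p
  have h₁ : M (p + 1) ≤ M q * weightQuot M p ^ k := by
    rw [hk]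
    exact hM.le_mul_pow q k hk.ge
  have h₂ := pow_div_factorial_le_three_pow (p + 1) k
  have hMq := hM.pos q
  rw [hkq]
  calc M (p + 1) * ((s * ((p + 1) / weightQuot M p)) ^ k / (k ! : ℝ))
      ≤ M q * weightQuot M p ^ k * ((s * ((p + 1) / weightQuot M p)) ^ k / (k ! : ℝ)) := by
        gcongr
    _ = M q * s ^ k * (((p + 1 : ℕ) : ℝ) ^ k / (k ! : ℝ)) := by
        rw [mul_pow, div_pow]
        push_cast
        field_simp
    _ ≤ M q * s ^ k * 3 ^ (p + 1) := by gcongr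
    _ = (3 * s) ^ (p + 1) * (s⁻¹ ^ q * M q) := by
        rw [mul_pow, hk, pow_add s, inv_pow]
        field_simp

namespace WhitneyJet

variable {a s ρ : ℝ}

/-- At the scale of the order `p`, the difference of two Taylor polynomials of order `p` is in the
class of `M`, with a factor that is geometric in `p` with ratio `3 * s`. -/
theorem abs_dirWord_jetPoly_sub_le' (h : WhitneyJet K M B c) (hM : ScaleRegular a M) (hs : 0 < s)
    {p : ℕ} (hρ : (d + 2) * ρ = s * ((p + 1) / weightQuot M p)) {x x' z : EuclideanSpace ℝ (Fin d)}
    (hx : x ∈ K) (hx' : x' ∈ K) (hz : ‖z - x‖ ≤ ρ) (hz' : ‖z - x'‖ ≤ ρ) (w : List (Fin d)) :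
    |dirWord (stdDir d) w (fun z => jetPoly c p 0 x z - jetPoly c p 0 x' z) z| ≤
      B * (3 * s) ^ (p + 1) * s⁻¹ ^ w.length * M w.length := by
  rw [dirWord_sub _ (contDiff_jetPoly _ _ _ _) (contDiff_jetPoly _ _ _ _)]
  by_cases hw : w.length ≤ p
  · have h₁ := h.abs_dirWord_jetPoly_sub_le hM.pos hx hx' hz hz' w hw
    rw [hρ] at h₁
    have h₂ := mul_le_mul_of_nonneg_left
      (hM.mul_pow_div_factorial_le hs (hw.trans (Nat.le_succ p))) h.nonneg
    linarith
  · have := h.nonneg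
    have := hM.pos w.length
    rw [dirWord_jetPoly, dirWord_jetPoly, if_neg hw, if_neg hw, sub_self, abs_zero]
    positivity

theorem abs_dirWord_jetPoly_succ_sub_le' (h : WhitneyJet K M B c) (hM : ScaleRegular a M)
    (hs : 0 < s) {p : ℕ} (hρ : (d + 2) * ρ = s * ((p + 1) / weightQuot M p))
    {x x' z : EuclideanSpace ℝ (Fin d)} (hx : x ∈ K) (hx' : x' ∈ K) (hz : ‖z - x‖ ≤ ρ)
    (hz' : ‖z - x'‖ ≤ ρ) (w : List (Fin d)) :
    |dirWord (stdDir d) w (fun z => jetPoly c (p + 1) 0 x z - jetPoly c p 0 x' z) z| ≤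
      2 * B * (3 * s) ^ (p + 1) * s⁻¹ ^ w.length * M w.length := by
  have h₁ := h.abs_dirWord_jetPoly_sub_le' hM hs hρ hx hx' hz hz' w
  rw [dirWord_sub _ (contDiff_jetPoly _ _ _ _) (contDiff_jetPoly _ _ _ _)] at h₁ ⊢
  have h₂ : |dirWord (stdDir d) w (jetPoly c (p + 1) 0 x) z -
      dirWord (stdDir d) w (jetPoly c p 0 x) z| ≤
      B * (3 * s) ^ (p + 1) * s⁻¹ ^ w.length * M w.length := by
    by_cases hw : w.length ≤ p + 1
    · have h₁ := h.abs_dirWord_jetPoly_succ_sub_le hM.pos hx hz w hw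
      rw [hρ] at h₁
      have h₂ := mul_le_mul_of_nonneg_left (hM.mul_pow_div_factorial_le hs hw) h.nonneg
      linarith
    · have := h.nonneg
      have := hM.pos w.length
      rw [dirWord_jetPoly, dirWord_jetPoly, if_neg hw, if_neg (by omega), sub_self, abs_zero]
      positivity
  have h₃ := abs_sub_le (dirWord (stdDir d) w (jetPoly c (p + 1) 0 x) z)
    (dirWord (stdDir d) w (jetPoly c p 0 x) z) (dirWord (stdDir d) w (jetPoly c p 0 x') z)
  linarith

end WhitneyJet

theorem jetPoly_self (c : (Fin d → ℕ) → EuclideanSpace ℝ (Fin d) → ℝ) (m : ℕ) (α : Fin d → ℕ)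
    (x : EuclideanSpace ℝ (Fin d)) : jetPoly c m α x x = c α x := by
  have hne : ∀ δ : Fin d → ℕ, δ ≠ 0 → divPow δ (x - x) = 0 := by
    intro δ hδ
    obtain ⟨i, hi⟩ := Function.ne_iff.1 hδ
    exact Finset.prod_eq_zero (Finset.mem_univ i) (by
      have : (x - x) i = 0 := by simp
      rw [this, zero_pow hi, zero_div])
  rw [jetPoly, sum_miLE m fun _ δ => c (α + δ) x * divPow δ (x - x), Finset.sum_eq_single 0]
  · simp [divPow]
  · intro δ _ hδ
    rw [hne δ hδ, mul_zero]
  · intro h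
    exact absurd (mem_miLE.2 (by simp [miOrder])) h

end Estimates

/-! ### The extension operators -/

section Extension

variable {d : ℕ}

/-- Operators from jets on `K` to functions on `ℝ^d` that are finite sums of terms
`c ↦ c δ x • u` with `x ∈ K` and `u` smooth. -/
inductive JetOp (K : Set (EuclideanSpace ℝ (Fin d))) :
    (((Fin d → ℕ) → EuclideanSpace ℝ (Fin d) → ℝ) → EuclideanSpace ℝ (Fin d) → ℝ) → Prop
  | single (δ : Fin d → ℕ) (x : EuclideanSpace ℝ (Fin d)) (hx : x ∈ K)
      (u : EuclideanSpace ℝ (Fin d) → ℝ) (hu : ContDiff ℝ ∞ u) : JetOp K fun c z => c δ x * u z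
  | zero : JetOp K fun _ _ => 0
  | add (Φ₁ Φ₂ : ((Fin d → ℕ) → EuclideanSpace ℝ (Fin d) → ℝ) → EuclideanSpace ℝ (Fin d) → ℝ)
      (h₁ : JetOp K Φ₁) (h₂ : JetOp K Φ₂) : JetOp K fun c z => Φ₁ c z + Φ₂ c z

namespace JetOp

variable {K : Set (EuclideanSpace ℝ (Fin d))}
  {Φ Φ' : ((Fin d → ℕ) → EuclideanSpace ℝ (Fin d) → ℝ) → EuclideanSpace ℝ (Fin d) → ℝ}

theorem contDiff (h : JetOp K Φ) (c : (Fin d → ℕ) → EuclideanSpace ℝ (Fin d) → ℝ) :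
    ContDiff ℝ ∞ (Φ c) := by
  induction h with
  | single δ x hx u hu => exact contDiff_const.mul hu
  | zero => exact contDiff_const
  | add Φ₁ Φ₂ _ _ ih₁ ih₂ => exact ih₁.add ih₂

theorem sum {ι : Type*} (s : Finset ι)
    {Φ : ι → ((Fin d → ℕ) → EuclideanSpace ℝ (Fin d) → ℝ) → EuclideanSpace ℝ (Fin d) → ℝ}
    (h : ∀ i ∈ s, JetOp K (Φ i)) : JetOp K fun c z => ∑ i ∈ s, Φ i c z := by
  classical
  induction s using Finset.induction_on with
  | empty => simpa using JetOp.zero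
  | insert i s hi ih =>
    simp only [Finset.sum_insert hi]
    exact JetOp.add _ _ (h i (Finset.mem_insert_self i s))
      (ih fun j hj => h j (Finset.mem_insert_of_mem hj))

theorem mul_left (h : JetOp K Φ) {v : EuclideanSpace ℝ (Fin d) → ℝ} (hv : ContDiff ℝ ∞ v) :
    JetOp K fun c z => v z * Φ c z := by
  induction h with
  | single δ x hx u hu =>
    simpa only [mul_left_comm] using JetOp.single δ x hx (fun z => v z * u z) (hv.mul hu)
  | zero => simpa using JetOp.zero
  | add Φ₁ Φ₂ _ _ ih₁ ih₂ => simpa only [mul_add] using JetOp.add _ _ ih₁ ih₂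

theorem sub (h : JetOp K Φ) (h' : JetOp K Φ') : JetOp K fun c z => Φ c z - Φ' c z := by
  simpa only [neg_one_mul, ← sub_eq_add_neg] using
    JetOp.add _ _ h (h'.mul_left (v := fun _ => -1) contDiff_const)

theorem jetPoly (m : ℕ) {x : EuclideanSpace ℝ (Fin d)} (hx : x ∈ K) :
    JetOp K fun c z => jetPoly c m 0 x z := by
  unfold _root_.jetPoly
  refine JetOp.sum _ fun j _ => JetOp.sum _ fun δ _ => ?_
  simpa only [zero_add] using JetOp.single δ x hx _ (contDiff_divPow_sub δ x)

end JetOp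

theorem abs_dirWord_mul_le_of_geometric {a : ℝ} {M : ℕ → ℝ} (hM : ScaleRegular a M)
    {z : EuclideanSpace ℝ (Fin d)} {u v : EuclideanSpace ℝ (Fin d) → ℝ} (hu : ContDiff ℝ ∞ u)
    (hv : ContDiff ℝ ∞ v) {R H H' : ℝ} (hR : 0 ≤ R) (hH : 0 ≤ H) (hH' : 0 ≤ H')
    (ha : ∀ w, |dirWord (stdDir d) w u z| ≤ H * R ^ w.length * M w.length)
    (hb : ∀ w, |dirWord (stdDir d) w v z| ≤ H' * R ^ w.length * M w.length) (w : List (Fin d)) :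
    |dirWord (stdDir d) w (fun z => u z * v z) z| ≤
      H * H' * (2 * R) ^ w.length * M w.length := by
  have := abs_dirWord_mul_le (stdDir d) w hu hv (a := fun i => H * R ^ i * M i)
    (b := fun i => H' * R ^ i * M i) (c := fun i => H * H' * R ^ i * M i) ha hb (fun i j => by
      have := mul_le_mul_of_nonneg_left (hM.mul_le i j)
        (by positivity : 0 ≤ H * H' * R ^ (i + j))
      rw [pow_add] at this ⊢
      linarith)
  rw [mul_pow]
  linarith

theorem abs_sum_le_of_support {ι : Type*} {I S : Finset ι} (hS : S ⊆ I) {f : ι → ℝ} {H : ℝ} {n : ℕ}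
    (hH : 0 ≤ H) (hcard : S.card ≤ n) (h0 : ∀ k ∈ I, k ∉ S → f k = 0) (h : ∀ k ∈ S, |f k| ≤ H) :
    |∑ k ∈ I, f k| ≤ n * H := by
  rw [← Finset.sum_subset hS h0]
  refine (Finset.abs_sum_le_sum_abs _ _).trans ((Finset.sum_le_card_nsmul _ _ H h).trans ?_)
  rw [nsmul_eq_mul]
  exact mul_le_mul_of_nonneg_right (by exact_mod_cast hcard) hH

/-- The partitions of unity at the scale of the order `p`, with bounds in the class of `M` that
are geometric in `p`. -/
theorem exists_partition_of_order {a : ℝ} {M : ℕ → ℝ} (hM : ScaleRegular a M)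
    {K : Set (EuclideanSpace ℝ (Fin d))} (hK : Bornology.IsBounded K) {κ : ℝ} (hκ : 0 < κ) (p : ℕ) :
    ∃ (I : Finset (Fin d → ℕ)) (Ψ : (Fin d → ℕ) → EuclideanSpace ℝ (Fin d) → ℝ)
      (pt : (Fin d → ℕ) → EuclideanSpace ℝ (Fin d)),
      (∀ k ∈ I, pt k ∈ K) ∧ (∀ k, ContDiff ℝ ∞ (Ψ k)) ∧
      (∀ z, ∃ S ⊆ I, S.card ≤ 3 ^ d ∧
        (∀ k ∈ I, k ∉ S → ∀ w, dirWord (stdDir d) w (Ψ k) z = 0) ∧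
        ∀ k ∈ S, ‖z - pt k‖ ≤ (4 * d + 1) * (κ * ((p + 1) / weightQuot M p))) ∧
      (∀ x ∈ K, ∀ᶠ z in nhds x, ∑ k ∈ I, Ψ k z = 1) ∧
      ∀ k w z, |dirWord (stdDir d) w (Ψ k) z| ≤
        (2 * a ^ p) ^ d * (4 * (a + 1) / κ) ^ w.length * M w.length := by
  have ha := hM.one_le
  obtain ⟨g, hg, h0, h1, hb⟩ := hM.exists_step hκ p
  have hm := hM.quot_pos p
  obtain ⟨I, Ψ, pt, h₁, h₂, h₃, h₄, h₅⟩ := exists_grid_partition hK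
    (by positivity : 0 < κ * ((p + 1) / weightQuot M p)) hg h0 h1
  refine ⟨I, Ψ, pt, h₁, h₂, h₃, h₄, fun k w z => (h₅ _ hb k w z).trans ?_⟩
  have e : ∏ i : Fin d, (2 * (a ^ p * (4 * (a + 1) / κ) ^ w.count i * M (w.count i))) =
      (2 * a ^ p) ^ d * (4 * (a + 1) / κ) ^ w.length * ∏ i : Fin d, M (w.count i) := by
    simp only [← mul_assoc]
    rw [Finset.prod_mul_distrib, Finset.prod_mul_distrib, Finset.prod_const,
      Finset.prod_pow_eq_pow_sum, ← length_eq_sum_count]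
    simp
  rw [e]
  have := hM.prod_le Finset.univ fun i => w.count i
  rw [← length_eq_sum_count] at this
  exact mul_le_mul_of_nonneg_left this (by positivity)

end Extension

section Core

/-- The extension of jets in the first variable alone, as a series of operators. The `p`-th partial
sum agrees near `K` with `∑ k, Ψ k * T k`, where the `Ψ k` form the partition of unity at the scale
of the order `p` and `T k` is the Taylor polynomial of order `p` at a point of `K` near the `k`-th
cell; the factors `Ψ k * Ψ l` confine each term of the series to a neighbourhood of `K` of that
scale. The scale is a small multiple `κ` of the quotient `(p + 1) / (M (p + 1) / M p)`: this makes
the remainders smaller than the bounds on the partitions of unity are large. -/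
theorem exists_extension_operators (d : ℕ) {a : ℝ} (ha : 1 ≤ a) :
    ∃ C₀ C₁ : ℝ, 0 < C₀ ∧ 0 < C₁ ∧ ∀ M : ℕ → ℝ, ScaleRegular a M →
      ∀ K : Set (EuclideanSpace ℝ (Fin d)), Bornology.IsBounded K →
      ∃ Φ : ℕ → ((Fin d → ℕ) → EuclideanSpace ℝ (Fin d) → ℝ) → EuclideanSpace ℝ (Fin d) → ℝ,
        (∀ p, JetOp K (Φ p)) ∧ ∀ B c, WhitneyJet K M B c →
          (∀ p w z, |dirWord (stdDir d) w (Φ p c) z| ≤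
            B * C₀ * (1 / 2) ^ p * C₁ ^ w.length * M w.length) ∧
          ∀ x ∈ K, ∀ w, HasSum (fun p => dirWord (stdDir d) w (Φ p c) x)
            (c (fun i => w.count i) x) := by
  -- `lam * κ * ((p + 1) / m p)` bounds `d + 2` times the distances at the scale of the order `p`,
  -- and `κ` is such that `3 * s`, with `s = lam * κ`, outweighs the growth of the partitions.
  set lam : ℝ := 2 * (4 * d + 1) * (d + 2) with hlam
  have hlam1 : 1 ≤ lam := by
    have : (0 : ℝ) ≤ d := Nat.cast_nonneg d
    rw [hlam]
    nlinarith
  have hD : 0 < (a ^ 2) ^ d := by positivity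
  set κ : ℝ := 1 / (6 * lam * (a ^ 2) ^ d) with hκdef
  have hκ : 0 < κ := by positivity
  set s : ℝ := lam * κ with hs
  have hs0 : 0 < s := by positivity
  have hsD : 3 * s * (a ^ 2) ^ d = 1 / 2 := by
    rw [hs, hκdef]
    field_simp
    norm_num
  set R : ℝ := 4 * (a + 1) / κ with hR
  have hR0 : 0 < R := by positivity
  have hsR : s⁻¹ ≤ R := by
    rw [hR, hs, inv_eq_one_div]
    gcongr
    · linarith
    · nlinarith
  refine ⟨2 * 36 ^ d, 2 * (2 * R), by positivity, by positivity, fun M hM K hK => ?_⟩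
  choose I Ψ pt hpt hΨ hS hone hbd using fun p => exists_partition_of_order hM hK hκ p
  -- The bounds on two consecutive partitions of unity are absorbed by the remainders.
  have habsorb : ∀ p : ℕ, (2 * a ^ (p + 1)) ^ d * (2 * a ^ p) ^ d * (3 * s) ^ (p + 1) ≤
      4 ^ d * (1 / 2) ^ (p + 1) := by
    intro p
    have h₁ : 2 * a ^ (p + 1) * (2 * a ^ p) ≤ 4 * (a ^ 2) ^ (p + 1) := by
      have : a ^ p ≤ a ^ (p + 1) := pow_le_pow_right₀ ha (Nat.le_succ p)
      have h₂ := mul_le_mul_of_nonneg_left this (by positivity : 0 ≤ 4 * a ^ (p + 1))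
      have h₃ : (a ^ 2) ^ (p + 1) = a ^ (p + 1) * a ^ (p + 1) := by ring
      rw [h₃]
      linarith
    rw [← mul_pow, ← hsD, mul_pow (3 * s)]
    calc (2 * a ^ (p + 1) * (2 * a ^ p)) ^ d * (3 * s) ^ (p + 1)
        ≤ (4 * (a ^ 2) ^ (p + 1)) ^ d * (3 * s) ^ (p + 1) := by gcongr
      _ = 4 ^ d * ((3 * s) ^ (p + 1) * ((a ^ 2) ^ d) ^ (p + 1)) := by
        rw [mul_pow, ← pow_mul (a ^ 2), ← pow_mul (a ^ 2), mul_comm (p + 1) d]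
        ring
  set ρ : ℕ → ℝ := fun p => 2 * ((4 * d + 1) * (κ * ((p + 1) / weightQuot M p))) with hρ
  have hρeq : ∀ p : ℕ, (d + 2) * ρ p = s * ((p + 1) / weightQuot M p) := fun p => by
    rw [hρ, hs, hlam]; ring
  have hρ1 : ∀ p : ℕ, (4 * d + 1) * (κ * ((p + 1) / weightQuot M p)) ≤ ρ p := fun p => by
    have := hM.quot_pos p
    have : 0 ≤ (4 * d + 1) * (κ * (((p : ℝ) + 1) / weightQuot M p)) := by positivity
    simp only [hρ]
    linarith
  have hρ2 : ∀ p : ℕ, (4 * d + 1) * (κ * (((p + 1 : ℕ) + 1) / weightQuot M (p + 1))) ≤ ρ p :=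
    fun p => by
    have h₁ := hM.scale p
    have h₂ := mul_le_mul_of_nonneg_left h₁ (by positivity : 0 ≤ (4 * (d : ℝ) + 1) * κ)
    simp only [hρ]
    push_cast
    rw [show (p : ℝ) + 1 + 1 = p + 2 by ring]
    linarith
  have hweak : ∀ {H t t' : ℝ} (q : ℕ), 0 ≤ H → 0 ≤ t → t ≤ t' →
      H * t ^ q * M q ≤ H * t' ^ q * M q := by
    intro H t t' q hH ht htt
    have := hM.pos q
    gcongr
  set Φ : ℕ → ((Fin d → ℕ) → EuclideanSpace ℝ (Fin d) → ℝ) → EuclideanSpace ℝ (Fin d) → ℝ :=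
    fun p => match p with
    | 0 => fun c z => ∑ k ∈ I 0, Ψ 0 k z * jetPoly c 0 0 (pt 0 k) z
    | p + 1 => fun c z => ∑ k ∈ I (p + 1), ∑ l ∈ I p, Ψ (p + 1) k z *
        (Ψ p l z * (jetPoly c (p + 1) 0 (pt (p + 1) k) z - jetPoly c p 0 (pt p l) z)) with hΦ
  have hop : ∀ p, JetOp K (Φ p) := by
    intro p
    cases p with
    | zero => exact JetOp.sum _ fun k hk => (JetOp.jetPoly 0 (hpt 0 k hk)).mul_left (hΨ 0 k)
    | succ p =>
      exact JetOp.sum _ fun k hk => JetOp.sum _ fun l hl =>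
        (((JetOp.jetPoly (p + 1) (hpt _ k hk)).sub
          (JetOp.jetPoly p (hpt _ l hl))).mul_left (hΨ p l)).mul_left (hΨ (p + 1) k)
  refine ⟨Φ, hop, fun B c hc => ?_⟩
  have hB := hc.nonneg
  have hTc : ∀ m x, ContDiff ℝ ∞ (jetPoly c m 0 x) := fun m x => contDiff_jetPoly c m 0 x
  have hbound : ∀ p w z, |dirWord (stdDir d) w (Φ p c) z| ≤
      B * (2 * 36 ^ d) * (1 / 2) ^ p * (2 * (2 * R)) ^ w.length * M w.length := by
    intro p w z
    have hMw := hM.pos w.length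
    cases p with
    | zero =>
      obtain ⟨S, hSI, hcard, hS0, hSz⟩ := hS 0 z
      have hterm : ∀ k ∈ S, |dirWord (stdDir d) w
          (fun z => Ψ 0 k z * jetPoly c 0 0 (pt 0 k) z) z| ≤
          (2 * a ^ 0) ^ d * B * (2 * R) ^ w.length * M w.length := fun k hk => by
        refine abs_dirWord_mul_le_of_geometric hM (hΨ 0 k) (hTc _ _) hR0.le (by positivity) hB
          (fun w => hbd 0 k w z) (fun w => ?_) w
        rw [dirWord_jetPoly]
        by_cases hw : w.length ≤ 0
        · have hw0 : w = [] := List.length_eq_zero_iff.1 (by omega)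
          subst hw0
          have h₁ := hc.bound 0 _ (hpt 0 k (hSI hk))
          have h₂ : miOrder (0 : Fin d → ℕ) = 0 := by simp [miOrder]
          have h₃ : jetPoly c 0 0 (pt 0 k) z = c 0 (pt 0 k) := by
            rw [jetPoly, sum_miLE 0 fun _ δ => c (0 + δ) (pt 0 k) * divPow δ (z - pt 0 k)]
            have : miLE d 0 = {0} := by
              ext δ
              rw [mem_miLE, Finset.mem_singleton, Nat.le_zero, miOrder, Finset.sum_eq_zero_iff]
              exact ⟨fun h => funext fun i => h i (Finset.mem_univ i), fun h => by simp [h]⟩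
            rw [this]
            simp [divPow]
          rw [h₂] at h₁
          have h₄ : (fun i : Fin d => ([] : List (Fin d)).count i) = 0 := by funext i; simp
          rw [if_pos hw, h₄, List.length_nil, Nat.sub_zero, h₃, pow_zero, mul_one]
          exact h₁
        · have := hM.pos w.length
          rw [if_neg hw, abs_zero]
          positivity
      have hsum := abs_sum_le_of_support hSI (n := 3 ^ d)
        (f := fun k => dirWord (stdDir d) w (fun z => Ψ 0 k z * jetPoly c 0 0 (pt 0 k) z) z)
        (by positivity) hcard
        (fun k hk hkS => dirWord_mul_eq_zero _ w (hΨ 0 k) (hTc _ _) (hS0 k hk hkS)) hterm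
      have e : dirWord (stdDir d) w (Φ 0 c) z = _ :=
        dirWord_sum _ (I 0) (fun k _ => (hΨ 0 k).mul (hTc 0 (pt 0 k))) w z
      rw [e]
      refine hsum.trans ?_
      have h36 : (3 : ℝ) ^ d * 2 ^ d ≤ 2 * 36 ^ d := by
        rw [← mul_pow]
        have : (3 * 2 : ℝ) ^ d ≤ 36 ^ d := by gcongr; norm_num
        have : (0 : ℝ) < 36 ^ d := by positivity
        linarith
      have hw4 : (2 * R) ^ w.length ≤ (2 * (2 * R)) ^ w.length := by gcongr; linarith
      push_cast
      calc (3 : ℝ) ^ d * ((2 * a ^ 0) ^ d * B * (2 * R) ^ w.length * M w.length)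
          = (3 ^ d * 2 ^ d) * B * (2 * R) ^ w.length * M w.length := by simp; ring
        _ ≤ (2 * 36 ^ d) * B * (2 * (2 * R)) ^ w.length * M w.length := by gcongr
        _ = B * (2 * 36 ^ d) * (1 / 2) ^ 0 * (2 * (2 * R)) ^ w.length * M w.length := by ring
    | succ p =>
      obtain ⟨S, hSI, hcard, hS0, hSz⟩ := hS (p + 1) z
      obtain ⟨S', hSI', hcard', hS0', hSz'⟩ := hS p z
      have hQc : ∀ k l, ContDiff ℝ ∞ fun z =>
          jetPoly c (p + 1) 0 (pt (p + 1) k) z - jetPoly c p 0 (pt p l) z :=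
        fun k l => (hTc _ _).sub (hTc _ _)
      set H : ℝ := (2 * a ^ (p + 1)) ^ d * ((2 * a ^ p) ^ d * (2 * B * (3 * s) ^ (p + 1))) with hH
      have hterm : ∀ k ∈ S, ∀ l ∈ S', |dirWord (stdDir d) w (fun z => Ψ (p + 1) k z *
          (Ψ p l z * (jetPoly c (p + 1) 0 (pt (p + 1) k) z - jetPoly c p 0 (pt p l) z))) z| ≤
          H * (2 * (2 * R)) ^ w.length * M w.length := fun k hk l hl => by
        refine abs_dirWord_mul_le_of_geometric hM (hΨ _ k) ((hΨ _ l).mul (hQc k l))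
          (by positivity) (by positivity) (by positivity)
          (fun w => (hbd _ k w z).trans (hweak _ (by positivity) hR0.le (by linarith)))
          (fun w => ?_) w
        refine abs_dirWord_mul_le_of_geometric hM (hΨ _ l) (hQc k l) hR0.le (by positivity)
          (by positivity) (fun w => hbd p l w z) (fun w => ?_) w
        exact (hc.abs_dirWord_jetPoly_succ_sub_le' hM hs0 (hρeq p) (hpt _ k (hSI hk))
          (hpt _ l (hSI' hl)) ((hSz k hk).trans (hρ2 p)) ((hSz' l hl).trans (hρ1 p)) w).trans
          (hweak _ (by positivity) (by positivity) hsR)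
      have hzero : ∀ k ∈ I (p + 1), k ∉ S → ∀ l, dirWord (stdDir d) w (fun z => Ψ (p + 1) k z *
          (Ψ p l z * (jetPoly c (p + 1) 0 (pt (p + 1) k) z - jetPoly c p 0 (pt p l) z))) z = 0 :=
        fun k hk hkS l => dirWord_mul_eq_zero _ w (hΨ _ k) ((hΨ _ l).mul (hQc k l)) (hS0 k hk hkS)
      have hzero' : ∀ k, ∀ l ∈ I p, l ∉ S' → dirWord (stdDir d) w (fun z => Ψ (p + 1) k z *
          (Ψ p l z * (jetPoly c (p + 1) 0 (pt (p + 1) k) z - jetPoly c p 0 (pt p l) z))) z = 0 := by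
        intro k l hl hlS
        simp only [mul_left_comm (Ψ (p + 1) k _)]
        exact dirWord_mul_eq_zero _ w (hΨ _ l) ((hΨ _ k).mul (hQc k l)) (hS0' l hl hlS)
      have e : dirWord (stdDir d) w (Φ (p + 1) c) z = ∑ k ∈ I (p + 1), ∑ l ∈ I p,
          dirWord (stdDir d) w (fun z => Ψ (p + 1) k z *
          (Ψ p l z * (jetPoly c (p + 1) 0 (pt (p + 1) k) z - jetPoly c p 0 (pt p l) z))) z := by
        refine (dirWord_sum _ (I (p + 1)) (fun k _ => ContDiff.sum fun l _ =>
          (hΨ _ k).mul ((hΨ _ l).mul (hQc k l))) w z).trans (Finset.sum_congr rfl fun k _ => ?_)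
        exact dirWord_sum _ (I p) (fun l _ => (hΨ _ k).mul ((hΨ _ l).mul (hQc k l))) w z
      rw [e]
      refine (abs_sum_le_of_support hSI (n := 3 ^ d)
        (H := (3 ^ d : ℕ) * (H * (2 * (2 * R)) ^ w.length * M w.length)) (by positivity) hcard
        (fun k hk hkS => Finset.sum_eq_zero fun l _ => hzero k hk hkS l)
        fun k hk => abs_sum_le_of_support hSI' (by positivity) hcard' (hzero' k)
          (hterm k hk)).trans ?_
      push_cast
      calc (3 : ℝ) ^ d * (3 ^ d * (H * (2 * (2 * R)) ^ w.length * M w.length))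
          = B * (2 * 9 ^ d) * ((2 * a ^ (p + 1)) ^ d * (2 * a ^ p) ^ d * (3 * s) ^ (p + 1)) *
            (2 * (2 * R)) ^ w.length * M w.length := by
            rw [hH, show (9 : ℝ) = 3 * 3 by norm_num, mul_pow (3 : ℝ) 3]; ring
        _ ≤ B * (2 * 9 ^ d) * (4 ^ d * (1 / 2) ^ (p + 1)) *
            (2 * (2 * R)) ^ w.length * M w.length := by
            have := mul_le_mul_of_nonneg_left (habsorb p) (by positivity :
              0 ≤ B * (2 * 9 ^ d) * ((2 * (2 * R)) ^ w.length * M w.length))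
            linarith
        _ = B * (2 * 36 ^ d) * (1 / 2) ^ (p + 1) * (2 * (2 * R)) ^ w.length * M w.length := by
            rw [show (36 : ℝ) = 9 * 4 by norm_num, mul_pow (9 : ℝ) 4]; ring
  refine ⟨hbound, fun x hx w => ?_⟩
  have hMw := hM.pos w.length
  -- Near `K` the series telescopes.
  have htele : ∀ n, ∀ᶠ z in nhds x, ∑ p ∈ Finset.range (n + 1), Φ p c z =
      ∑ k ∈ I n, Ψ n k z * jetPoly c n 0 (pt n k) z := by
    intro n
    induction n with
    | zero => exact Filter.Eventually.of_forall fun z => by simp [hΦ]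
    | succ n ih =>
      filter_upwards [ih, hone n x hx, hone (n + 1) x hx] with z h₁ h₂ h₃
      rw [Finset.sum_range_succ, h₁]
      have e : Φ (n + 1) c z =
          (∑ k ∈ I (n + 1), Ψ (n + 1) k z * jetPoly c (n + 1) 0 (pt (n + 1) k) z) *
            (∑ l ∈ I n, Ψ n l z) -
          (∑ k ∈ I (n + 1), Ψ (n + 1) k z) * ∑ l ∈ I n, Ψ n l z * jetPoly c n 0 (pt n l) z := by
        rw [Finset.sum_mul_sum, Finset.sum_mul_sum, ← Finset.sum_sub_distrib]
        refine Finset.sum_congr rfl fun k _ => ?_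
        rw [← Finset.sum_sub_distrib]
        exact Finset.sum_congr rfl fun l _ => by ring
      rw [e, h₂, h₃]
      ring
  have hsummable : Summable fun p => dirWord (stdDir d) w (Φ p c) x := by
    refine Summable.of_norm_bounded (g := fun p => B * (2 * 36 ^ d) * (1 / 2) ^ p *
      (2 * (2 * R)) ^ w.length * M w.length) ?_ fun p => hbound p w x
    exact (((summable_geometric_of_lt_one (by norm_num) (by norm_num)).mul_left _).mul_right
      _).mul_right _
  rw [hsummable.hasSum_iff_tendsto_nat, ← Filter.tendsto_add_atTop_iff_nat 1,
    tendsto_iff_norm_sub_tendsto_zero]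
  have hlim : Filter.Tendsto (fun n : ℕ => 3 ^ d * 4 ^ d * B * (2 * R) ^ w.length * M w.length *
      (1 / 2 : ℝ) ^ (n + 1)) Filter.atTop (nhds 0) := by
    have := ((tendsto_pow_atTop_nhds_zero_of_lt_one (r := (1 / 2 : ℝ)) (by norm_num)
      (by norm_num)).comp (Filter.tendsto_add_atTop_nat 1)).const_mul
      (3 ^ d * 4 ^ d * B * (2 * R) ^ w.length * M w.length)
    simpa using this
  refine squeeze_zero' (Filter.Eventually.of_forall fun n => norm_nonneg _) ?_ hlim
  filter_upwards [Filter.eventually_ge_atTop w.length] with n hn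
  obtain ⟨S, hSI, hcard, hS0, hSz⟩ := hS n x
  have hQc : ∀ k, ContDiff ℝ ∞ fun z => jetPoly c n 0 (pt n k) z - jetPoly c n 0 x z :=
    fun k => (hTc _ _).sub (hTc _ _)
  have hnear : (fun z => ∑ p ∈ Finset.range (n + 1), Φ p c z) =ᶠ[nhds x] fun z =>
      jetPoly c n 0 x z + ∑ k ∈ I n, Ψ n k z * (jetPoly c n 0 (pt n k) z - jetPoly c n 0 x z) := by
    filter_upwards [htele n, hone n x hx] with z h₁ h₂
    rw [h₁]
    simp only [mul_sub]
    rw [Finset.sum_sub_distrib, ← Finset.sum_mul, h₂]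
    ring
  have hsum : ∑ p ∈ Finset.range (n + 1), dirWord (stdDir d) w (Φ p c) x =
      c (fun i => w.count i) x + ∑ k ∈ I n, dirWord (stdDir d) w
        (fun z => Ψ n k z * (jetPoly c n 0 (pt n k) z - jetPoly c n 0 x z)) x := by
    rw [← dirWord_sum _ _ (fun p _ => (hop p).contDiff c), (dirWord_congr _ hnear w).eq_of_nhds,
      dirWord_add _ (hTc _ _) (ContDiff.sum fun k _ => (hΨ n k).mul (hQc k)),
      dirWord_sum _ _ (fun k _ => (hΨ n k).mul (hQc k)), dirWord_jetPoly, if_pos hn, jetPoly_self]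
  rw [hsum, add_sub_cancel_left, Real.norm_eq_abs]
  have hρ0 : 0 ≤ ρ n := by
    have := hM.quot_pos n
    simp only [hρ]
    positivity
  refine (abs_sum_le_of_support hSI (n := 3 ^ d)
    (H := (2 * a ^ n) ^ d * (B * (3 * s) ^ (n + 1)) * (2 * R) ^ w.length * M w.length)
    (by positivity) hcard
    (fun k hk hkS => dirWord_mul_eq_zero _ w (hΨ n k) (hQc k) (hS0 k hk hkS))
    fun k hk => ?_).trans ?_
  · refine abs_dirWord_mul_le_of_geometric hM (hΨ n k) (hQc k) hR0.le (by positivity)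
      (by positivity) (fun w => hbd n k w x) (fun w => ?_) w
    exact (hc.abs_dirWord_jetPoly_sub_le' hM hs0 (hρeq n) (hpt n k (hSI hk)) hx
      ((hSz k hk).trans (hρ1 n)) (by simpa using hρ0) w).trans
      (hweak _ (by positivity) (by positivity) hsR)
  · push_cast
    have h₁ : (2 * a ^ n) ^ d * (3 * s) ^ (n + 1) ≤ 4 ^ d * (1 / 2) ^ (n + 1) := by
      refine le_trans ?_ (habsorb n)
      have : 1 ≤ (2 * a ^ (n + 1)) ^ d :=
        one_le_pow₀ (by nlinarith [one_le_pow₀ ha (n := n + 1)])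
      rw [mul_assoc]
      exact le_mul_of_one_le_left (by positivity) this
    calc (3 : ℝ) ^ d * ((2 * a ^ n) ^ d * (B * (3 * s) ^ (n + 1)) * (2 * R) ^ w.length * M w.length)
        = 3 ^ d * B * (2 * R) ^ w.length * M w.length * ((2 * a ^ n) ^ d * (3 * s) ^ (n + 1)) := by
          ring
      _ ≤ 3 ^ d * B * (2 * R) ^ w.length * M w.length * (4 ^ d * (1 / 2) ^ (n + 1)) := by gcongr
      _ = 3 ^ d * 4 ^ d * B * (2 * R) ^ w.length * M w.length * (1 / 2 : ℝ) ^ (n + 1) := by ring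

end Core

/-! ### Dependence on the second variable -/

section Mixed

variable {d e : ℕ}

theorem clm_eq_sum_proj (L : EuclideanSpace ℝ (Fin d) →L[ℝ] ℝ) :
    L = ∑ i, L (stdDir d i) • (EuclideanSpace.proj i : EuclideanSpace ℝ (Fin d) →L[ℝ] ℝ) := by
  refine ContinuousLinearMap.ext fun v => ?_
  have hv : v = ∑ i, v i • stdDir d i := by
    refine (((EuclideanSpace.basisFun (Fin d) ℝ).sum_repr v).symm).trans ?_
    simp [stdDir]
  conv_lhs => rw [hv]
  rw [map_sum, sum_apply]
  refine Finset.sum_congr rfl fun i _ => ?_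
  rw [map_smul, smul_apply, smul_eq_mul, smul_eq_mul, mul_comm]
  rfl

/-- The differential on `ℝ^d × ℝ^e` with partial derivatives `a i` and `b j`. -/
noncomputable def mixedDiff (a : Fin d → ℝ) (b : Fin e → ℝ) :
    EuclideanSpace ℝ (Fin d) × EuclideanSpace ℝ (Fin e) →L[ℝ] ℝ :=
  ∑ i, a i • (EuclideanSpace.proj i : EuclideanSpace ℝ (Fin d) →L[ℝ] ℝ).comp
      (ContinuousLinearMap.fst ℝ _ _) +
    ∑ j, b j • (EuclideanSpace.proj j : EuclideanSpace ℝ (Fin e) →L[ℝ] ℝ).comp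
      (ContinuousLinearMap.snd ℝ _ _)

theorem mixedDiff_apply (a : Fin d → ℝ) (b : Fin e → ℝ)
    (v : EuclideanSpace ℝ (Fin d) × EuclideanSpace ℝ (Fin e)) :
    mixedDiff a b v = ∑ i, a i * v.1 i + ∑ j, b j * v.2 j := by
  rw [mixedDiff, add_apply, sum_apply, sum_apply]
  rfl

theorem mixedDiff_fst (a : Fin d → ℝ) (b : Fin e → ℝ) (i : Fin d) :
    mixedDiff a b (EuclideanSpace.single i (1 : ℝ), 0) = a i := by
  simp [mixedDiff_apply]

theorem mixedDiff_snd (a : Fin d → ℝ) (b : Fin e → ℝ) (j : Fin e) :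
    mixedDiff a b (0, EuclideanSpace.single j (1 : ℝ)) = b j := by
  simp [mixedDiff_apply]

theorem norm_mixedDiff_le (a : Fin d → ℝ) (b : Fin e → ℝ) :
    ‖mixedDiff a b‖ ≤ ∑ i, |a i| + ∑ j, |b j| := by
  refine ContinuousLinearMap.opNorm_le_bound _ (by positivity) fun v => ?_
  rw [mixedDiff_apply, Real.norm_eq_abs, add_mul, Finset.sum_mul, Finset.sum_mul]
  refine (abs_add_le _ _).trans (add_le_add ?_ ?_)
  · refine (Finset.abs_sum_le_sum_abs _ _).trans (Finset.sum_le_sum fun i _ => ?_)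
    rw [abs_mul]
    exact mul_le_mul_of_nonneg_left
      ((EuclideanSpace.abs_apply_le_norm v.1 i).trans (norm_fst_le v)) (abs_nonneg _)
  · refine (Finset.abs_sum_le_sum_abs _ _).trans (Finset.sum_le_sum fun i _ => ?_)
    rw [abs_mul]
    exact mul_le_mul_of_nonneg_left
      ((EuclideanSpace.abs_apply_le_norm v.2 i).trans (norm_snd_le v)) (abs_nonneg _)

theorem hasSum_mixedDiff {a : Fin d → ℕ → ℝ} {b : Fin e → ℕ → ℝ} {a' : Fin d → ℝ} {b' : Fin e → ℝ}
    (ha : ∀ i, HasSum (a i) (a' i)) (hb : ∀ j, HasSum (b j) (b' j)) :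
    HasSum (fun p => mixedDiff (fun i => a i p) fun j => b j p) (mixedDiff a' b') :=
  (hasSum_sum fun i _ => (ha i).smul_const _).add (hasSum_sum fun j _ => (hb j).smul_const _)

/-- A family of functions on `U ⊆ ℝ^d × ℝ^e` in which the entries of index `(α + 1ᵢ, β)` and
`(α, β + 1ⱼ)` are the partial derivatives of the entry of index `(α, β)`. -/
def IsMixedJet (U : Set (EuclideanSpace ℝ (Fin d) × EuclideanSpace ℝ (Fin e)))
    (H : (Fin d → ℕ) → (Fin e → ℕ) →
      EuclideanSpace ℝ (Fin d) × EuclideanSpace ℝ (Fin e) → ℝ) : Prop :=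
  ∀ α β, ∀ z ∈ U, HasFDerivAt (H α β) (mixedDiff (fun i => H (α + Pi.single i 1) β z)
    fun j => H α (β + Pi.single j 1) z) z

namespace IsMixedJet

variable {U : Set (EuclideanSpace ℝ (Fin d) × EuclideanSpace ℝ (Fin e))}
  {H : (Fin d → ℕ) → (Fin e → ℕ) → EuclideanSpace ℝ (Fin d) × EuclideanSpace ℝ (Fin e) → ℝ}

theorem contDiffOn (h : IsMixedJet U H) (hU : IsOpen U) (α : Fin d → ℕ) (β : Fin e → ℕ) :
    ContDiffOn ℝ ∞ (H α β) U := by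
  rw [contDiffOn_infty]
  intro n
  induction n generalizing α β with
  | zero =>
    rw [Nat.cast_zero, contDiffOn_zero]
    exact fun z hz => (h α β z hz).continuousAt.continuousWithinAt
  | succ n ih =>
    rw [Nat.cast_succ, contDiffOn_succ_iff_fderiv_of_isOpen hU]
    refine ⟨fun z hz => (h α β z hz).differentiableAt.differentiableWithinAt, by simp, ?_⟩
    have hc : ContDiffOn ℝ n (fun z => mixedDiff (fun i => H (α + Pi.single i 1) β z)
        fun j => H α (β + Pi.single j 1) z) U := by
      unfold mixedDiff
      exact (ContDiffOn.sum fun i _ => (ih _ _).smul contDiffOn_const).add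
        (ContDiffOn.sum fun j _ => (ih _ _).smul contDiffOn_const)
    exact hc.congr fun z hz => (h α β z hz).fderiv

theorem mixedDeriv_eqOn (h : IsMixedJet U H) (hU : IsOpen U) (α : Fin d → ℕ) (β : Fin e → ℕ) :
    Set.EqOn (mixedDeriv α β (H 0 0)) (H α β) U := by
  have h₁ : Set.EqOn (multiDeriv (fun j => ((0 : EuclideanSpace ℝ (Fin d)),
      EuclideanSpace.single j (1 : ℝ))) β (H 0 0)) (H 0 β) U := by
    have := dirWord_eqOn (fun j => ((0 : EuclideanSpace ℝ (Fin d)),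
      EuclideanSpace.single j (1 : ℝ))) hU (fun β => H 0 β) (fun j β => β + Pi.single j 1)
      (fun j β z hz => by rw [(h 0 β z hz).fderiv, mixedDiff_snd]) (f := H 0 0) (a := 0)
      (fun z _ => rfl) (miWord β)
    rw [foldr_add_single] at this
    rw [multiDeriv_eq_dirWord]
    simpa [count_miWord] using this
  have := dirWord_eqOn (fun i => (EuclideanSpace.single i (1 : ℝ),
    (0 : EuclideanSpace ℝ (Fin e)))) hU (fun α => H α β) (fun i α => α + Pi.single i 1)
    (fun i α z hz => by rw [(h α β z hz).fderiv, mixedDiff_fst]) (a := 0) h₁ (miWord α)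
  rw [foldr_add_single] at this
  rw [mixedDeriv, multiDeriv_eq_dirWord]
  simpa [count_miWord] using this

/-- Series of mixed jets may be differentiated term by term if all entries converge uniformly. -/
theorem isMixedJet_tsum {H : ℕ → (Fin d → ℕ) → (Fin e → ℕ) →
      EuclideanSpace ℝ (Fin d) × EuclideanSpace ℝ (Fin e) → ℝ}
    (h : ∀ p, IsMixedJet U (H p)) (hU : IsOpen U) {V : (Fin d → ℕ) → (Fin e → ℕ) → ℕ → ℝ}
    (hV : ∀ α β, Summable (V α β)) (hb : ∀ α β p, ∀ z ∈ U, |H p α β z| ≤ V α β p) :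
    IsMixedJet U fun α β z => ∑' p, H p α β z := by
  intro α β z hz
  have hs : ∀ α β, ∀ z ∈ U, Summable fun p => H p α β z := fun α β z hz =>
    Summable.of_norm_bounded (hV α β) fun p => hb α β p z hz
  obtain ⟨ε, hε, hball⟩ := Metric.isOpen_iff.1 hU z hz
  have hbd : ∀ p, ∀ x ∈ Metric.ball z ε,
      ‖mixedDiff (fun i => H p (α + Pi.single i 1) β x) (fun j => H p α (β + Pi.single j 1) x)‖ ≤
        ∑ i, V (α + Pi.single i 1) β p + ∑ j, V α (β + Pi.single j 1) p := fun p x hx =>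
    (norm_mixedDiff_le _ _).trans (add_le_add
      (Finset.sum_le_sum fun i _ => hb _ _ p x (hball hx))
      (Finset.sum_le_sum fun j _ => hb _ _ p x (hball hx)))
  have hVs : Summable fun p => ∑ i, V (α + Pi.single i 1) β p + ∑ j, V α (β + Pi.single j 1) p :=
    (summable_sum fun i _ => hV _ _).add (summable_sum fun j _ => hV _ _)
  have hd := hasFDerivAt_tsum_of_isPreconnected (𝕜 := ℝ) (f := fun p => H p α β)
    hVs Metric.isOpen_ball (convex_ball z ε).isPreconnected
    (fun p x hx => h p α β x (hball hx)) hbd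
    (Metric.mem_ball_self hε) (hs α β z hz) (Metric.mem_ball_self hε)
  have e := (hasSum_mixedDiff (fun i => (hs (α + Pi.single i 1) β z hz).hasSum)
    fun j => (hs α (β + Pi.single j 1) z hz).hasSum).tsum_eq
  rw [← e]
  exact hd

end IsMixedJet

theorem miWord_single (j : Fin d) : miWord (Pi.single j 1) = [j] := by
  refine List.perm_singleton.1 (List.perm_iff_count.2 fun i => ?_)
  rw [count_miWord]
  by_cases h : i = j
  · subst h; simp
  · have : ¬ j = i := fun h' => h h'.symm
    simp [h, this]

variable {K : Set (EuclideanSpace ℝ (Fin d))} {Y : Set (EuclideanSpace ℝ (Fin e))}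
  {F : (Fin d → ℕ) → (Fin e → ℕ) → EuclideanSpace ℝ (Fin d) × EuclideanSpace ℝ (Fin e) → ℝ}

theorem IsPartialJet.hasFDerivAt (hF : IsPartialJet K Y F) (hY : IsOpen Y) (α : Fin d → ℕ)
    (β : Fin e → ℕ) {x : EuclideanSpace ℝ (Fin d)} (hx : x ∈ K) {y : EuclideanSpace ℝ (Fin e)}
    (hy : y ∈ Y) :
    HasFDerivAt (fun y => F α β (x, y)) (∑ j, F α (β + Pi.single j 1) (x, y) •
      (EuclideanSpace.proj j : EuclideanSpace ℝ (Fin e) →L[ℝ] ℝ)) y := by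
  obtain ⟨hs, hd⟩ := (hF α β).2 x hx
  have h := ((hs.contDiffAt (hY.mem_nhds hy)).differentiableAt (by simp)).hasFDerivAt
  rw [clm_eq_sum_proj (fderiv ℝ (fun y => F α β (x, y)) y)] at h
  refine h.congr_fderiv (Finset.sum_congr rfl fun j _ => ?_)
  congr 1
  symm
  rw [← hd (Pi.single j 1) y hy, partialDeriv, multiDeriv_eq_dirWord, miWord_single]
  rfl

/-- An operator on jets in the first variable, applied with the second variable as a parameter,
gives a mixed jet. -/
theorem JetOp.isMixedJet
    {Φ : ((Fin d → ℕ) → EuclideanSpace ℝ (Fin d) → ℝ) → EuclideanSpace ℝ (Fin d) → ℝ}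
    (h : JetOp K Φ) (hF : IsPartialJet K Y F) (hY : IsOpen Y) :
    IsMixedJet (Set.univ ×ˢ Y) fun α β z =>
      dirWord (stdDir d) (miWord α) (Φ fun δ x => F δ β (x, z.2)) z.1 := by
  induction h with
  | single δ x hx u hu =>
    intro α β z hz
    simp only [dirWord_const_mul _ hu]
    have h₁ := (hF.hasFDerivAt hY δ β hx hz.2).comp z
      (ContinuousLinearMap.snd ℝ (EuclideanSpace ℝ (Fin d)) (EuclideanSpace ℝ (Fin e))).hasFDerivAt
    have h₂ := (hu.dirWord (stdDir d) (miWord α)).differentiable_infty.differentiableAt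
      (x := z.1) |>.hasFDerivAt.comp z
      (ContinuousLinearMap.fst ℝ (EuclideanSpace ℝ (Fin d)) (EuclideanSpace ℝ (Fin e))).hasFDerivAt
    have h₃ : ∀ i, fderiv ℝ (dirWord (stdDir d) (miWord α) u) z.1 (stdDir d i) =
        dirWord (stdDir d) (miWord (α + Pi.single i 1)) u z.1 := fun i => by
      rw [← dirWord_cons_miWord _ hu]
      rfl
    refine (h₁.mul h₂).congr_fderiv (ContinuousLinearMap.ext fun v => ?_)
    rw [clm_eq_sum_proj (fderiv ℝ (dirWord (stdDir d) (miWord α) u) z.1)]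
    simp only [h₃, mixedDiff_apply, add_apply, smul_apply, ContinuousLinearMap.comp_apply,
      sum_apply, smul_eq_mul, Finset.mul_sum, Function.comp_apply, ContinuousLinearMap.coe_fst',
      ContinuousLinearMap.coe_snd', EuclideanSpace.coe_proj]
    refine congrArg₂ _ (Finset.sum_congr rfl fun i _ => ?_) (Finset.sum_congr rfl fun j _ => ?_)
    · ring
    · ring
  | zero =>
    intro α β z hz
    simp only [dirWord_zero]
    refine (hasFDerivAt_const (0 : ℝ) z).congr_fderiv (ContinuousLinearMap.ext fun v => ?_)
    simp [mixedDiff_apply]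
  | add Φ₁ Φ₂ h₁ h₂ ih₁ ih₂ =>
    intro α β z hz
    simp only [dirWord_add _ (h₁.contDiff _) (h₂.contDiff _)]
    refine ((ih₁ α β z hz).add (ih₂ α β z hz)).congr_fderiv (ContinuousLinearMap.ext fun v => ?_)
    simp only [mixedDiff_apply, add_apply, add_mul, Finset.sum_add_distrib]
    ring

end Mixed

theorem theoremC6 (d e : ℕ) (M N : ℕ → ℝ) (hM : IsWeightSequence M) (hN : IsWeightSequence N) :
    ∃ C₀ C₁ : ℝ, 0 < C₀ ∧ 0 < C₁ ∧
      ∀ (Y : Set (EuclideanSpace ℝ (Fin e))) (K : Set (EuclideanSpace ℝ (Fin d)))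
        (F : (Fin d → ℕ) → (Fin e → ℕ) →
          EuclideanSpace ℝ (Fin d) × EuclideanSpace ℝ (Fin e) → ℝ)
        (A L₁ L₂ : ℝ),
        IsOpen Y → IsCompact K → 0 ≤ A → 0 < L₁ → 0 < L₂ →
        IsPartialJet K Y F →
        (∀ α β, ∀ z ∈ K ×ˢ Y,
          |F α β z| ≤ A * L₁ ^ miOrder α * L₂ ^ miOrder β * M (miOrder α) * N (miOrder β)) →
        (∀ (n : ℕ) (k : Fin d → ℕ) (l : Fin e → ℕ), miOrder k ≤ n →
          ∀ x ∈ K, ∀ z ∈ K ×ˢ Y,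
            |jetRemainder F n k l x z| ≤
              A * L₁ ^ (n + 1) * M (n + 1) * L₂ ^ miOrder l * N (miOrder l) *
                (‖z.1 - x‖ ^ (n - miOrder k + 1) / ((n - miOrder k + 1)! : ℝ))) →
        ∃ f : EuclideanSpace ℝ (Fin d) × EuclideanSpace ℝ (Fin e) → ℝ,
          MemAniso M N Set.univ Y f ∧
          (∀ α β, ∀ z ∈ K ×ˢ Y, mixedDeriv α β f z = F α β z) ∧
          anisoNorm M N (C₁ * L₁) L₂ Set.univ Y f ≤ ENNReal.ofReal (C₀ * A) := by
  obtain ⟨a, ha⟩ := hM.exists_scaleRegular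
  obtain ⟨C₀, C₁, hC₀, hC₁, hext⟩ := exists_extension_operators d ha.one_le
  refine ⟨C₀ * 2, C₁, by positivity, hC₁, ?_⟩
  intro Y K F A L₁ L₂ hY hK hA hL₁ hL₂ hF hbd hrem
  obtain ⟨Φ, hop, hΦ⟩ := hext _ (ha.rescale hL₁) K hK.isBounded
  have hMpos := ha.pos
  have hNpos := hN.1
  -- For fixed `y` and `β`, the functions `F δ β (·, y)` form a Whitney jet on `K`.
  have hjet : ∀ β, ∀ y ∈ Y, WhitneyJet K (fun k => L₁ ^ k * M k)
      (A * (L₂ ^ miOrder β * N (miOrder β))) fun δ x => F δ β (x, y) := by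
    intro β y hy
    have := hNpos (miOrder β)
    refine ⟨by positivity, fun α x hx => ?_, fun n α hα x hx z hz => ?_⟩
    · have := hbd α β (x, y) ⟨hx, hy⟩
      linarith
    · have h₁ := hrem n α β hα x hx (z, y) ⟨hz, hy⟩
      have h₂ : jetRemainder F n α β x (z, y) =
          F α β (z, y) - jetPoly (fun δ x => F δ β (x, y)) (n - miOrder α) α x z := by
        simp only [jetRemainder, jetTaylor, jetPoly, div_miFactorial_mul_miPow]
      rw [h₂] at h₁
      refine h₁.trans (le_of_eq ?_)
      ring
  set U : Set (EuclideanSpace ℝ (Fin d) × EuclideanSpace ℝ (Fin e)) := Set.univ ×ˢ Y with hUdef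
  have hU : IsOpen U := isOpen_univ.prod hY
  set H : ℕ → (Fin d → ℕ) → (Fin e → ℕ) →
      EuclideanSpace ℝ (Fin d) × EuclideanSpace ℝ (Fin e) → ℝ := fun p α β z =>
    dirWord (stdDir d) (miWord α) (Φ p fun δ x => F δ β (x, z.2)) z.1 with hH
  set W : (Fin d → ℕ) → (Fin e → ℕ) → ℝ := fun α β => A * (L₂ ^ miOrder β * N (miOrder β)) * C₀ *
    (C₁ ^ miOrder α * (L₁ ^ miOrder α * M (miOrder α))) with hW
  have hHb : ∀ α β p, ∀ z ∈ U, |H p α β z| ≤ W α β * (1 / 2) ^ p := by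
    intro α β p z hz
    have h₁ := (hΦ _ _ (hjet β z.2 hz.2)).1 p (miWord α) z.1
    rw [length_miWord] at h₁
    refine h₁.trans (le_of_eq ?_)
    rw [hW]
    ring
  have hgeom : Summable fun p : ℕ => (1 / 2 : ℝ) ^ p := summable_geometric_two
  have hG := IsMixedJet.isMixedJet_tsum (fun p => (hop p).isMixedJet hF hY) hU
    (V := fun α β p => W α β * (1 / 2) ^ p) (fun α β => hgeom.mul_left _) hHb
  have hGb : ∀ α β, ∀ z ∈ U, |∑' p, H p α β z| ≤ W α β * 2 := by
    intro α β z hz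
    rw [← tsum_geometric_two, ← tsum_mul_left]
    exact tsum_of_norm_bounded (f := fun p => H p α β z) (hgeom.mul_left _).hasSum
      fun p => hHb α β p z hz
  have hmixed := fun α β => hG.mixedDeriv_eqOn hU α β
  have hnorm : anisoNorm M N (C₁ * L₁) L₂ Set.univ Y (fun z => ∑' p, H p 0 0 z) ≤
      ENNReal.ofReal (C₀ * 2 * A) := by
    refine iSup₂_le fun z hz => iSup₂_le fun α β => ENNReal.ofReal_le_ofReal ?_
    have hMα := hMpos (miOrder α)
    have hNβ := hNpos (miOrder β)
    rw [hmixed α β hz, div_le_iff₀ (by positivity)]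
    refine (hGb α β z hz).trans (le_of_eq ?_)
    rw [hW, mul_pow]
    ring
  refine ⟨fun z => ∑' p, H p 0 0 z, ⟨hG.contDiffOn hU 0 0, C₁ * L₁, L₂, by positivity, hL₂,
    hnorm.trans_lt ENNReal.ofReal_lt_top⟩, fun α β z hz => ?_, hnorm⟩
  rw [hmixed α β ⟨Set.mem_univ _, hz.2⟩]
  have := (hΦ _ _ (hjet β z.2 hz.2)).2 z.1 hz.1 (miWord α)
  simp only [count_miWord] at this
  exact this.tsum_eq
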